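/- For $m\in\{0,1,2,\dots\}$ let $C_m=\frac{1}{m+1}\binom{2m}{m}$ be the $m$-th Catalan number, and let $C_x=0$ for every rational number $x$ that is not a nonnegative integer. For $n\ge 3$, a $k$-dissection of a convex $n$-gon is a partition of it into $k+1$ polygons by $k$ pairwise non-crossing diagonals; for $n \ge 4$, an almost-triangulation is an $(n-4)$-dissection. The vertices of the $n$-gon are labelled cyclically by $0,1,\dots,n-1$, and the cyclic group $\mathbb{Z}_n$ acts on the set $G(n,k)$ of $k$-dissections by the rotations $v\mapsto v+i \pmod n$. The nonempty faces of the $(n-3)$-dimensional associahedron are the dissections of the $n$-gon, ordered by reverse inclusion of their sets of diagonals, with the induced action of $\mathbb{Z}_n$; its edges are its one-dimensional faces. Let $n\ge 4$. The number $|G(n,n-4)/\mathbb{Z}_n|$ of almost-triangulations of an $n$-gon modulo the cyclic action is $$\frac{n-3}{2n}\,C_{n-2}+\frac12\,C_{n/4-1}+\frac14\,C_{n/2-1},$$ and the number of edges of the $(n-3)$-dimensional associahedron modulo the cyclic action is given by the same formula. -/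

import Mathlib

namespace PolygonDissection

/-- The vertices of a convex `n`-gon are `0, 1, …, n - 1` in cyclic order, and a pair of vertices
is an element of `Sym2 (Fin n)`. A pair is a side if it has the form `{v, v + 1}` modulo `n`. -/
def IsSide {n : ℕ} (e : Sym2 (Fin n)) : Prop :=
  ∃ v : Fin n, e = s(v, finRotate n v)

/-- A diagonal joins two distinct vertices and is not a side. -/
def IsDiagonal {n : ℕ} (e : Sym2 (Fin n)) : Prop :=
  ¬ e.IsDiag ∧ ¬ IsSide e

/-- Two chords of a convex polygon cross (in an interior point of both) if and only if their end
points are four distinct vertices which alternate around the polygon. -/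
def Crossing {n : ℕ} (e f : Sym2 (Fin n)) : Prop :=
  ∃ a c b d : Fin n, a < c ∧ c < b ∧ b < d ∧
    ((e = s(a, b) ∧ f = s(c, d)) ∨ (e = s(c, d) ∧ f = s(a, b)))

/-- A dissection is given by a finite set of pairwise non-crossing diagonals. -/
def IsDissection {n : ℕ} (Φ : Finset (Sym2 (Fin n))) : Prop :=
  (∀ e ∈ Φ, IsDiagonal e) ∧ ∀ e ∈ Φ, ∀ f ∈ Φ, ¬ Crossing e f

/-- The cyclic group of rotations of the `n`-gon, generated by `v ↦ v + 1` modulo `n`, as a group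
of permutations of the vertices. -/
abbrev Rotations (n : ℕ) : Subgroup (Equiv.Perm (Fin n)) :=
  Subgroup.zpowers (finRotate n)

/-- The image of a set of chords under a permutation of the vertices. -/
def permute {n : ℕ} (g : Equiv.Perm (Fin n)) (Φ : Finset (Sym2 (Fin n))) :
    Finset (Sym2 (Fin n)) :=
  Φ.image (Sym2.map g)

theorem permute_one {n : ℕ} (Φ : Finset (Sym2 (Fin n))) : permute 1 Φ = Φ := by
  simp [permute]

theorem permute_mul {n : ℕ} (g h : Equiv.Perm (Fin n)) (Φ : Finset (Sym2 (Fin n))) :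
    permute (g * h) Φ = permute g (permute h Φ) := by
  simp [permute, Finset.image_image, Equiv.Perm.coe_mul, Sym2.map_comp]

theorem card_permute {n : ℕ} (g : Equiv.Perm (Fin n)) (Φ : Finset (Sym2 (Fin n))) :
    (permute g Φ).card = Φ.card :=
  Finset.card_image_of_injective _ (Sym2.map.injective g.injective)

theorem isSide_of_rotate {n : ℕ} {e : Sym2 (Fin n)}
    (h : IsSide (Sym2.map (finRotate n) e)) : IsSide e := by
  obtain ⟨v, hv⟩ := h
  refine ⟨(finRotate n).symm v, ?_⟩
  apply Sym2.map.injective (finRotate n).injective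
  rw [hv, Sym2.map_mk, Equiv.apply_symm_apply]

theorem crossing_rotate {n : ℕ} {e f : Sym2 (Fin n)} (h : Crossing e f) :
    Crossing (Sym2.map (finRotate n) e) (Sym2.map (finRotate n) f) := by
  obtain ⟨a, c, b, d, h1, h2, h3, h⟩ := h
  cases n with
  | zero => exact a.elim0
  | succ m =>
    have key : ∀ x : Fin (m + 1), x < d →
        ((finRotate (m + 1) x : Fin (m + 1)) : ℕ) = x + 1 := by
      intro x hx
      apply coe_finRotate_of_ne_last
      intro hl
      rw [hl] at hx
      exact absurd hx (not_lt.mpr (Fin.le_last d))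
    have ka := key a (h1.trans (h2.trans h3))
    have kc := key c (h2.trans h3)
    have kb := key b h3
    by_cases hd : d = Fin.last m
    · have kd : ((finRotate (m + 1) d : Fin (m + 1)) : ℕ) = 0 := by
        rw [hd, finRotate_last]; rfl
      refine ⟨finRotate _ d, finRotate _ a, finRotate _ c, finRotate _ b, ?_, ?_, ?_, ?_⟩
      · rw [Fin.lt_def]; omega
      · rw [Fin.lt_def] at *; omega
      · rw [Fin.lt_def] at *; omega
      · rcases h with ⟨rfl, rfl⟩ | ⟨rfl, rfl⟩
        · right
          exact ⟨by simp, by simp [Sym2.eq_swap]⟩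
        · left
          exact ⟨by simp [Sym2.eq_swap], by simp⟩
    · have kd : ((finRotate (m + 1) d : Fin (m + 1)) : ℕ) = d + 1 :=
        coe_finRotate_of_ne_last hd
      refine ⟨finRotate _ a, finRotate _ c, finRotate _ b, finRotate _ d, ?_, ?_, ?_, ?_⟩
      · rw [Fin.lt_def] at *; omega
      · rw [Fin.lt_def] at *; omega
      · rw [Fin.lt_def] at *; omega
      · rcases h with ⟨rfl, rfl⟩ | ⟨rfl, rfl⟩
        · left
          exact ⟨by simp, by simp⟩
        · right
          exact ⟨by simp, by simp⟩

theorem crossing_pow_rotate {n : ℕ} {e f : Sym2 (Fin n)} (i : ℕ) (h : Crossing e f) :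
    Crossing (Sym2.map ((finRotate n) ^ i : Equiv.Perm (Fin n)) e)
      (Sym2.map ((finRotate n) ^ i : Equiv.Perm (Fin n)) f) := by
  induction i with
  | zero => simpa using h
  | succ i ih =>
    have := crossing_rotate ih
    rwa [Sym2.map_map, Sym2.map_map, ← Equiv.Perm.coe_mul, ← pow_succ'] at this

theorem isSide_of_pow_rotate {n : ℕ} {e : Sym2 (Fin n)} (i : ℕ)
    (h : IsSide (Sym2.map ((finRotate n) ^ i : Equiv.Perm (Fin n)) e)) : IsSide e := by
  induction i with
  | zero => simpa using h
  | succ i ih =>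
    apply ih
    apply isSide_of_rotate
    rwa [Sym2.map_map, ← Equiv.Perm.coe_mul, ← pow_succ']

theorem exists_pow_of_mem {n : ℕ} {g : Equiv.Perm (Fin n)} (hg : g ∈ Rotations n) :
    ∃ i : ℕ, (finRotate n) ^ i = g :=
  mem_powers_iff_mem_zpowers.mpr hg

theorem IsDissection.permute {n : ℕ} {g : Equiv.Perm (Fin n)} (hg : g ∈ Rotations n)
    {Φ : Finset (Sym2 (Fin n))} (h : IsDissection Φ) :
    IsDissection (PolygonDissection.permute g Φ) := by
  obtain ⟨i, rfl⟩ := exists_pow_of_mem hg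
  constructor
  · intro e he
    obtain ⟨e', he', rfl⟩ := Finset.mem_image.mp he
    refine ⟨fun hd => (h.1 e' he').1 ?_, fun hs => (h.1 e' he').2 (isSide_of_pow_rotate i hs)⟩
    exact (Sym2.isDiag_map (Equiv.injective _)).mp hd
  · intro e he f hf hc
    obtain ⟨e', he', rfl⟩ := Finset.mem_image.mp he
    obtain ⟨f', hf', rfl⟩ := Finset.mem_image.mp hf
    obtain ⟨j, hj⟩ := exists_pow_of_mem (Subgroup.inv_mem _ hg)
    have := crossing_pow_rotate j hc
    rw [hj, Sym2.map_map, Sym2.map_map, ← Equiv.Perm.coe_mul, inv_mul_cancel] at this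
    exact h.2 e' he' f' hf' (by simpa using this)

/-- The set of all dissections of the `n`-gon, ordered by inclusion of the sets of diagonals. -/
abbrev Dissection (n : ℕ) : Type :=
  {Φ : Finset (Sym2 (Fin n)) // IsDissection Φ}

/-- The cyclic group of rotations acts on the set of dissections. -/
instance instMulActionDissection (n : ℕ) : MulAction (Rotations n) (Dissection n) where
  smul g Φ := ⟨permute g.1 Φ.1, Φ.2.permute g.2⟩
  one_smul Φ := Subtype.ext (permute_one Φ.1)
  mul_smul g h Φ := Subtype.ext (permute_mul g.1 h.1 Φ.1)

/-- The set of `k`-dissections of the `n`-gon, with the action of the group of rotations. -/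
def kDissections (n k : ℕ) : SubMulAction (Rotations n) (Dissection n) where
  carrier := {Φ | Φ.1.card = k}
  smul_mem' g Φ h := (card_permute g.1 Φ.1).trans h

/-- The poset of nonempty faces of the `(n - 3)`-dimensional associahedron: the faces are the
dissections of the `n`-gon and a face is contained in another one if the diagonals of its
dissection include those of the other one. The empty dissection is the whole associahedron. -/
abbrev AssociahedronFace (n : ℕ) : Type := (Dissection n)ᵒᵈ

/-- The dimension of a face of the associahedron, read off the face poset as for every polytope:
the supremum of the lengths `d` of chains of nonempty faces `F₀ < F₁ < ⋯ < F_d = F`. -/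
noncomputable def faceDim {n : ℕ} (F : AssociahedronFace n) : ℕ∞ := Order.height F

/-- The rotations act on the face poset by order automorphisms. -/
def faceIso {n : ℕ} (g : Rotations n) : AssociahedronFace n ≃o AssociahedronFace n where
  toEquiv := MulAction.toPerm g
  map_rel_iff' {F G} := by
    change permute g.1 (OrderDual.ofDual G).1 ⊆ permute g.1 (OrderDual.ofDual F).1 ↔
      (OrderDual.ofDual G).1 ⊆ (OrderDual.ofDual F).1
    exact Finset.image_subset_image_iff (Sym2.map.injective g.1.injective)

/-- The set of edges (one-dimensional faces) of the associahedron, with the cyclic action. -/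
def associahedronEdges (n : ℕ) : SubMulAction (Rotations n) (AssociahedronFace n) where
  carrier := {F | faceDim F = 1}
  smul_mem' g F h := (Order.height_orderIso (faceIso g) F).trans h

/-- The Catalan number `C_x = binom(2x, x) / (x + 1)` if `x` is a nonnegative integer,
and `C_x = 0` for all other `x`. -/
def catalanOrZero (x : ℚ) : ℚ :=
  if x = (⌊x⌋₊ : ℚ) then ((2 * ⌊x⌋₊).choose ⌊x⌋₊ : ℚ) / ((⌊x⌋₊ : ℚ) + 1) else 0

end PolygonDissection

/-! An almost-triangulation has exactly one quadrilateral cell; its other cells are triangles.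
Cutting along the four sides of this quadrilateral leaves four triangulated polygons, possibly
degenerate to a side of the `n`-gon. Each is dual to a binary tree whose leaves are the sides of the
`n`-gon that it contains. A quadruple of trees with `n` leaves in total, together with the position
of a starting vertex, determines the dissection; forgetting the position divides by rotations, and
the choice of starting vertex is a `ZMod 4` ambiguity. Hence rotation classes correspond to `ZMod
4`-orbits of quadruples (`card_orbits_kDissections`). Existence of the quadrilateral is
`IsDissection.exists_isQuad`; its uniqueness is `IsQuad.cyclic_unique`.

Burnside's lemma then counts the orbits (`four_mul_card_orbits`). Gluing four trees under a root
gives `C_{n-1} - 2 C_{n-2} = (2(n-3)/n) C_{n-2}` quadruples. Those fixed by the half turn are pairs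
`(a, b, a, b)`, that is, trees with `n/2` leaves, numbering `C_{n/2-1}`. Those fixed by either
quarter turn are constant, numbering `C_{n/4-1}`.

Edges of the associahedron are the faces with `n - 4` diagonals, because every maximal dissection
has `n - 3` diagonals (`faceDim_eq_one_iff`).

To avoid case distinctions modulo `n`, chords are lifted to periodic arcs between natural numbers,
where betweenness is the linear order. -/

namespace PolygonDissection
open BinaryTree

/-! ### Binary trees as triangulated polygons on intervals of integers -/

/-- The chords `(i, j)` with `i + 2 ≤ j` of the triangulation of the polygon with vertices
`i, …, i + t.numLeaves` which is dual to the binary tree `t`, including the root edge. -/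
def nodeChords : BinaryTree Unit → ℕ → Finset (ℕ × ℕ)
  | .nil, _ => ∅
  | .node _ l r, i => insert (i, i + (l.numLeaves + r.numLeaves))
      (nodeChords l i ∪ nodeChords r (i + l.numLeaves))

/-- The chords of consecutive triangulated polygons. -/
def forestChords : List (BinaryTree Unit) → ℕ → Finset (ℕ × ℕ)
  | [], _ => ∅
  | t :: F, i => nodeChords t i ∪ forestChords F (i + t.numLeaves)

/-- The total number of leaves of a list of trees. -/
def forestLeaves (F : List (BinaryTree Unit)) : ℕ := (F.map numLeaves).sum

@[simp] theorem forestLeaves_nil : forestLeaves [] = 0 := rfl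

@[simp] theorem forestLeaves_cons (t : BinaryTree Unit) (F : List (BinaryTree Unit)) :
    forestLeaves (t :: F) = t.numLeaves + forestLeaves F := by simp [forestLeaves]

theorem length_le_forestLeaves (F : List (BinaryTree Unit)) : F.length ≤ forestLeaves F := by
  induction F with
  | nil => simp
  | cons t F ih => have := numLeaves_pos t; simp; omega

theorem nodeChords_bounds {t : BinaryTree Unit} {i : ℕ} {p : ℕ × ℕ} (hp : p ∈ nodeChords t i) :
    i ≤ p.1 ∧ p.1 + 2 ≤ p.2 ∧ p.2 ≤ i + t.numLeaves := by
  induction t generalizing i with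
  | nil => simp [nodeChords] at hp
  | node _ l r ihl ihr =>
    have h1 := numLeaves_pos l
    have h2 := numLeaves_pos r
    simp only [nodeChords, Finset.mem_insert, Finset.mem_union] at hp
    simp only [numLeaves]
    rcases hp with rfl | hp | hp
    · simp; omega
    · have := ihl hp; omega
    · have := ihr hp; omega

/-- The last bound holds because a chord lies over a single tree and each of the other trees has at
least one leaf. With three or more trees it keeps chords from closing up to a side modulo `n`. -/
theorem forestChords_bounds {F : List (BinaryTree Unit)} {i : ℕ} {p : ℕ × ℕ}
    (hp : p ∈ forestChords F i) :
    i ≤ p.1 ∧ p.1 + 2 ≤ p.2 ∧ p.2 ≤ i + forestLeaves F ∧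
      p.2 + F.length ≤ p.1 + forestLeaves F + 1 := by
  induction F generalizing i with
  | nil => simp [forestChords] at hp
  | cons t F ih =>
    have h1 := numLeaves_pos t
    have h2 := length_le_forestLeaves F
    simp only [forestChords, Finset.mem_union] at hp
    simp only [forestLeaves_cons, List.length_cons]
    rcases hp with hp | hp
    · have := nodeChords_bounds hp; omega
    · have := ih hp; omega

theorem nodeChords_noncrossing {t : BinaryTree Unit} {i : ℕ} {p q : ℕ × ℕ}
    (hp : p ∈ nodeChords t i) (hq : q ∈ nodeChords t i) :
    ¬ (p.1 < q.1 ∧ q.1 < p.2 ∧ p.2 < q.2) := by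
  induction t generalizing i with
  | nil => simp [nodeChords] at hp
  | node _ l r ihl ihr =>
    have hp' := nodeChords_bounds hp
    have hq' := nodeChords_bounds hq
    simp only [numLeaves] at hp' hq'
    simp only [nodeChords, Finset.mem_insert, Finset.mem_union] at hp hq
    rcases hp with rfl | hp | hp
    · simp only [] at *; omega
    · rcases hq with rfl | hq | hq
      · simp only [] at *; omega
      · exact ihl hp hq
      · have := nodeChords_bounds hp; have := nodeChords_bounds hq; omega
    · rcases hq with rfl | hq | hq
      · simp only [] at *; omega
      · have := nodeChords_bounds hp; have := nodeChords_bounds hq; omega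
      · exact ihr hp hq

theorem forestChords_noncrossing {F : List (BinaryTree Unit)} {i : ℕ} {p q : ℕ × ℕ}
    (hp : p ∈ forestChords F i) (hq : q ∈ forestChords F i) :
    ¬ (p.1 < q.1 ∧ q.1 < p.2 ∧ p.2 < q.2) := by
  induction F generalizing i with
  | nil => simp [forestChords] at hp
  | cons t F ih =>
    simp only [forestChords, Finset.mem_union] at hp hq
    rcases hp with hp | hp <;> rcases hq with hq | hq
    · exact nodeChords_noncrossing hp hq
    · have := nodeChords_bounds hp; have := forestChords_bounds hq; omega
    · have := forestChords_bounds hp; have := nodeChords_bounds hq; omega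
    · exact ih hp hq

theorem card_nodeChords (t : BinaryTree Unit) (i : ℕ) :
    (nodeChords t i).card + 1 = t.numLeaves := by
  induction t generalizing i with
  | nil => simp [nodeChords]
  | node _ l r ihl ihr =>
    have h1 := numLeaves_pos l
    have h2 := numLeaves_pos r
    rw [nodeChords, Finset.card_insert_of_notMem, Finset.card_union_of_disjoint]
    · have := ihl i; have := ihr (i + l.numLeaves); simp only [numLeaves]; omega
    · rw [Finset.disjoint_left]
      intro p hp hq
      have := nodeChords_bounds hp; have := nodeChords_bounds hq; omega
    · rw [Finset.mem_union]
      rintro (hp | hp) <;> have := nodeChords_bounds hp <;> simp only [] at this <;> omega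

theorem card_forestChords (F : List (BinaryTree Unit)) (i : ℕ) :
    (forestChords F i).card + F.length = forestLeaves F := by
  induction F generalizing i with
  | nil => simp [forestChords]
  | cons t F ih =>
    rw [forestChords, Finset.card_union_of_disjoint]
    · have := card_nodeChords t i; have := ih (i + t.numLeaves)
      simp only [forestLeaves_cons, List.length_cons]; omega
    · rw [Finset.disjoint_left]
      intro p hp hq
      have := nodeChords_bounds hp; have := forestChords_bounds hq; omega

theorem nodeChords_add (t : BinaryTree Unit) (i s : ℕ) :
    nodeChords t (i + s) = (nodeChords t i).image fun p => (p.1 + s, p.2 + s) := by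
  induction t generalizing i with
  | nil => simp [nodeChords]
  | node _ l r ihl ihr =>
    rw [nodeChords, nodeChords, Finset.image_insert, Finset.image_union, ihl,
      add_right_comm i s l.numLeaves, ihr, add_right_comm]

theorem forestChords_add (F : List (BinaryTree Unit)) (i s : ℕ) :
    forestChords F (i + s) = (forestChords F i).image fun p => (p.1 + s, p.2 + s) := by
  induction F generalizing i with
  | nil => simp [forestChords]
  | cons t F ih =>
    rw [forestChords, forestChords, Finset.image_union, nodeChords_add,
      add_right_comm i s t.numLeaves, ih]

/-! ### Periodic non-crossing arc systems -/

/-- An `n`-periodic system of pairwise non-crossing arcs, which contains the arcs of length one: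
the lift to the universal cover of the sides and diagonals of a dissection of an `n`-gon. -/
structure IsArcSystem (n : ℕ) (E : ℕ → ℕ → Prop) : Prop where
  lt : ∀ {a b}, E a b → a < b
  lt_add : ∀ {a b}, E a b → b < a + n
  side : ∀ a, E a (a + 1)
  symm : ∀ {a b}, E a b → E b (a + n)
  of_add : ∀ {a b}, E (a + n) (b + n) → E a b
  noncrossing : ∀ {a b c d}, E a b → E c d → a < c → c < b → b < d → d < a + n → False

namespace IsArcSystem
variable {n : ℕ} {E : ℕ → ℕ → Prop}

theorem add (hE : IsArcSystem n E) {a b : ℕ} (h : E a b) : E (a + n) (b + n) :=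
  hE.symm (hE.symm h)

theorem symm' (hE : IsArcSystem n E) {a b : ℕ} (h : E b (a + n)) : E a b :=
  hE.of_add (hE.symm h)

theorem root (hE : IsArcSystem n E) {t : BinaryTree Unit} {i : ℕ}
    (h : ∀ p ∈ nodeChords t i, E p.1 p.2) : E i (i + t.numLeaves) := by
  cases t with
  | nil => exact hE.side i
  | node _ l r => exact h (i, i + (l.numLeaves + r.numLeaves)) (by simp [nodeChords])

theorem node_iff {l r : BinaryTree Unit} {i : ℕ} :
    (∀ p ∈ nodeChords (.node () l r) i, E p.1 p.2) ↔
      E i (i + (l.numLeaves + r.numLeaves)) ∧ (∀ p ∈ nodeChords l i, E p.1 p.2) ∧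
        ∀ p ∈ nodeChords r (i + l.numLeaves), E p.1 p.2 := by
  simp only [nodeChords, Finset.mem_insert, Finset.mem_union, or_imp, forall_and, forall_eq]

/-- Over a given root edge the apex of the triangle is forced: two different apexes would give
crossing sides. Induction then treats the two subtrees. -/
theorem tree_unique (hE : IsArcSystem n E) {t t' : BinaryTree Unit} {i : ℕ}
    (h : ∀ p ∈ nodeChords t i, E p.1 p.2) (h' : ∀ p ∈ nodeChords t' i, E p.1 p.2)
    (hl : t.numLeaves = t'.numLeaves) : t = t' := by
  induction t generalizing i t' with
  | nil =>
    cases t' with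
    | nil => rfl
    | node _ l r =>
      have := numLeaves_pos l; have := numLeaves_pos r; simp only [numLeaves] at hl; omega
  | node _ l r ihl ihr =>
    cases t' with
    | nil => have := numLeaves_pos l; have := numLeaves_pos r; simp only [numLeaves] at hl; omega
    | node _ l' r' =>
      simp only [numLeaves] at hl
      obtain ⟨h0, hL, hR⟩ := node_iff.1 h
      obtain ⟨h0', hL', hR'⟩ := node_iff.1 h'
      have := hE.lt_add h0
      have e1 := hE.root hL
      have e2 := hE.root hR
      have e1' := hE.root hL'
      have e2' := hE.root hR'
      have := numLeaves_pos l; have := numLeaves_pos r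
      have := numLeaves_pos l'; have := numLeaves_pos r'
      have key : l.numLeaves = l'.numLeaves := by
        rcases lt_trichotomy l.numLeaves l'.numLeaves with h | h | h
        · exact (hE.noncrossing e1' e2 (by omega) (by omega) (by omega) (by omega)).elim
        · exact h
        · exact (hE.noncrossing e1 e2' (by omega) (by omega) (by omega) (by omega)).elim
      rw [ihl hL hL' key, ihr hR (key ▸ hR') (by omega)]

/-- A triangulated polygon admits no further arcs: an arc that straddles the apex of the root
triangle is the root edge or crosses one of the other two sides, and every other arc lies over a
subtree. -/
theorem mem_nodeChords (hE : IsArcSystem n E) {t : BinaryTree Unit} {i x y : ℕ}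
    (h : ∀ p ∈ nodeChords t i, E p.1 p.2) (hxy : E x y) (hx : i ≤ x) (hy : y ≤ i + t.numLeaves) :
    y = x + 1 ∨ (x, y) ∈ nodeChords t i := by
  have hlt := hE.lt hxy
  induction t generalizing i with
  | nil => simp only [numLeaves] at hy; omega
  | node _ l r ihl ihr =>
    simp only [numLeaves] at hy
    obtain ⟨h0, hL, hR⟩ := node_iff.1 h
    have := hE.lt_add h0
    have e1 := hE.root hL
    have e2 := hE.root hR
    simp only [nodeChords, Finset.mem_insert, Finset.mem_union, Prod.mk.injEq]
    by_cases c1 : y ≤ i + l.numLeaves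
    · have := ihl hL hx c1; tauto
    by_cases c2 : i + l.numLeaves ≤ x
    · have := ihr hR c2 (by omega); tauto
    rcases hx.eq_or_lt with rfl | hx
    · rcases hy.eq_or_lt with rfl | hy
      · tauto
      · exact (hE.noncrossing hxy e2 (by omega) (by omega) (by omega) (by omega)).elim
    · exact (hE.noncrossing e1 hxy (by omega) (by omega) (by omega) (by omega)).elim

/-- Descend in the tree until the apex of the root triangle lies strictly between `x` and `w`. Then
`x w` is the root edge, and by non-crossing the apex is `y` or `z`, so a side of the root triangle
is a diagonal of the quadrilateral. -/
theorem exists_diagonal_of_quad (hE : IsArcSystem n E) {t : BinaryTree Unit} {i x y z w : ℕ}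
    (h : ∀ p ∈ nodeChords t i, E p.1 p.2) (hx : i ≤ x) (hw : w ≤ i + t.numLeaves)
    (hxy : E x y) (hyz : E y z) (hzw : E z w) (hxw : E x w) : E x z ∨ E y w := by
  have l1 := hE.lt hxy
  have l2 := hE.lt hyz
  have l3 := hE.lt hzw
  induction t generalizing i with
  | nil => simp only [numLeaves] at hw; omega
  | node _ l r ihl ihr =>
    simp only [numLeaves] at hw
    obtain ⟨h0, hL, hR⟩ := node_iff.1 h
    have := hE.lt_add h0
    have e1 := hE.root hL
    have e2 := hE.root hR
    by_cases c1 : w ≤ i + l.numLeaves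
    · exact ihl hL hx c1
    by_cases c2 : i + l.numLeaves ≤ x
    · exact ihr hR c2 (by omega)
    have hx' : i = x := by
      by_contra hne
      exact hE.noncrossing e1 hxw (by omega) (by omega) (by omega) (by omega)
    have hw' : w = i + l.numLeaves + r.numLeaves := by
      by_contra hne
      exact hE.noncrossing hxw e2 (by omega) (by omega) (by omega) (by omega)
    subst hx'
    rw [← hw'] at e2
    by_cases c3 : z = i + l.numLeaves
    · rw [c3]; exact .inl e1
    by_cases c4 : y = i + l.numLeaves
    · rw [c4]; exact .inr e2
    exfalso
    rcases lt_or_ge (i + l.numLeaves) y with c5 | c5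
    · exact hE.noncrossing hxy e2 (by omega) (by omega) (by omega) (by omega)
    rcases lt_or_ge z (i + l.numLeaves) with c6 | c6
    · exact hE.noncrossing e1 hzw (by omega) (by omega) (by omega) (by omega)
    · exact hE.noncrossing e1 hyz (by omega) (by omega) (by omega) (by omega)

theorem add_forest (hE : IsArcSystem n E) {F : List (BinaryTree Unit)} {i : ℕ}
    (h : ∀ p ∈ forestChords F i, E p.1 p.2) : ∀ p ∈ forestChords F (i + n), E p.1 p.2 := by
  rw [forestChords_add]
  simp only [Finset.mem_image]
  rintro _ ⟨p, hp, rfl⟩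
  exact hE.add (h p hp)

theorem of_add_forest (hE : IsArcSystem n E) {F : List (BinaryTree Unit)} {i : ℕ}
    (h : ∀ p ∈ forestChords F (i + n), E p.1 p.2) : ∀ p ∈ forestChords F i, E p.1 p.2 := by
  rw [forestChords_add] at h
  intro p hp
  exact hE.of_add (h _ (Finset.mem_image_of_mem _ hp))

end IsArcSystem

/-! ### The empty quadrilateral and its uniqueness -/

/-- The trees `a`, `b`, `c`, `d` describe the four parts which the arc system `E` cuts off from the
sides of a quadrilateral that has a vertex at `s`, and the quadrilateral has no diagonal in `E`. -/
structure IsQuad (n : ℕ) (E : ℕ → ℕ → Prop) (s : ℕ) (a b c d : BinaryTree Unit) : Prop where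
  leaves : a.numLeaves + b.numLeaves + c.numLeaves + d.numLeaves = n
  chords : ∀ p ∈ forestChords [a, b, c, d] s, E p.1 p.2
  not_left : ¬ E s (s + a.numLeaves + b.numLeaves)
  not_right : ¬ E (s + a.numLeaves) (s + a.numLeaves + b.numLeaves + c.numLeaves)

namespace IsQuad
variable {n s s' : ℕ} {E : ℕ → ℕ → Prop} {a b c d a' b' c' d' : BinaryTree Unit}

theorem chords_iff : (∀ p ∈ forestChords [a, b, c, d] s, E p.1 p.2) ↔
    (∀ p ∈ nodeChords a s, E p.1 p.2) ∧ (∀ p ∈ nodeChords b (s + a.numLeaves), E p.1 p.2) ∧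
    (∀ p ∈ nodeChords c (s + a.numLeaves + b.numLeaves), E p.1 p.2) ∧
    (∀ p ∈ nodeChords d (s + a.numLeaves + b.numLeaves + c.numLeaves), E p.1 p.2) := by
  simp only [forestChords, Finset.mem_union, or_imp, forall_and, Finset.notMem_empty,
    false_imp_iff, and_true]

theorem add (hE : IsArcSystem n E) (h : IsQuad n E s a b c d) : IsQuad n E (s + n) a b c d where
  leaves := h.leaves
  chords := hE.add_forest h.chords
  not_left h' := h.not_left (hE.of_add (by convert h' using 1; omega))
  not_right h' := h.not_right (hE.of_add (by convert h' using 1 <;> omega))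

theorem of_add (hE : IsArcSystem n E) (h : IsQuad n E (s + n) a b c d) : IsQuad n E s a b c d where
  leaves := h.leaves
  chords := hE.of_add_forest h.chords
  not_left h' := h.not_left (by convert hE.add h' using 1; omega)
  not_right h' := h.not_right (by convert hE.add h' using 1 <;> omega)

theorem rotate (hE : IsArcSystem n E) (h : IsQuad n E s a b c d) :
    IsQuad n E (s + a.numLeaves) b c d a := by
  have hl := h.leaves
  refine ⟨by omega, ?_, h.not_right, fun h' => h.not_left (hE.symm' (by convert h' using 1; omega))⟩
  obtain ⟨h1, h2, h3, h4⟩ := chords_iff.1 h.chords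
  refine chords_iff.2 ⟨h2, h3, h4, ?_⟩
  have h5 := (chords_iff.1 (h.add hE).chords).1
  rwa [show s + a.numLeaves + b.numLeaves + c.numLeaves + d.numLeaves = s + n by omega]

/-- If a vertex of the second quadrilateral lies strictly under a side of the first, non-crossing
forces the whole second quadrilateral under that side. There everything is triangulated, so it would
have a diagonal. -/
theorem not_between (hE : IsArcSystem n E) (h : IsQuad n E s a b c d)
    (h' : IsQuad n E s' a' b' c' d') (h1 : s < s') (h2 : s' < s + a.numLeaves) : False := by
  have hl := h.leaves
  have hl' := h'.leaves
  have := numLeaves_pos a'; have := numLeaves_pos b'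
  have := numLeaves_pos c'; have := numLeaves_pos d'
  obtain ⟨t1, -, -, -⟩ := chords_iff.1 h.chords
  obtain ⟨u1, u2, u3, u4⟩ := chords_iff.1 h'.chords
  have e := hE.root t1
  have e1 := hE.root u1
  have e2 := hE.root u2
  have e3 := hE.root u3
  have e4 := hE.root u4
  have n1 := h'.not_left
  have n2 := h'.not_right
  have t1' := (chords_iff.1 (h.add hE).chords).1
  have e' := hE.symm e
  have e'' := hE.add e
  rw [show s' + a'.numLeaves + b'.numLeaves + c'.numLeaves + d'.numLeaves = s' + n by omega] at e4
  -- The second quadrilateral has the vertices `s'`, `x`, `y`, `z`; the side of the first runs from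
  -- `s` to `q`.
  generalize hx : s' + a'.numLeaves = x at *
  generalize hy : x + b'.numLeaves = y at *
  generalize hz : y + c'.numLeaves = z at *
  generalize hb : s + a.numLeaves = q at *
  have hqn : q < s + n := hE.lt_add e
  have e4' : E s' z := hE.symm' e4
  by_cases cx : q < x ∧ x < s + n
  · exact hE.noncrossing e e1 h1 h2 cx.1 cx.2
  by_cases cz : q < z ∧ z < s + n
  · exact hE.noncrossing e e4' h1 h2 cz.1 cz.2
  -- The opposite vertex `y` can lie outside without a crossing only if both neighbours are ends of
  -- the side; then the side itself is the forbidden diagonal `x z`.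
  by_cases cy : q < y ∧ y < s + n
  · by_cases ex : x = q
    · by_cases ez : z = s + n
      · rw [ex, ez] at n2; exact n2 e'
      · exact hE.noncrossing e' e3 cy.1 cy.2 (by omega) (by omega)
    · exact hE.noncrossing e e2 (by omega) (by omega) cy.1 cy.2
  -- All vertices are now under the side modulo `n`. The cases say how many of them have passed into
  -- the next period; except in the first case, the vertices are listed from the first one that has,
  -- and the tree is shifted by `n`.
  by_cases d1 : z ≤ q
  · exact (hE.exists_diagonal_of_quad t1 h1.le (by omega) e1 e2 e3 e4').elim n1 n2
  by_cases d2 : y ≤ q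
  · rcases hE.exists_diagonal_of_quad t1' (x := z) (by omega) (by omega) e4 (hE.add e1)
      (hE.add e2) (hE.symm e3) with g | g
    · exact n2 (hE.symm' g)
    · exact n1 (hE.of_add g)
  by_cases d3 : x ≤ q
  · rcases hE.exists_diagonal_of_quad t1' (x := y) (by omega) (by omega) e3 e4 (hE.add e1)
      (hE.symm e2) with g | g
    · exact n1 (hE.symm' g)
    · exact n2 (hE.symm' g)
  · rcases hE.exists_diagonal_of_quad t1' (x := x) (by omega) (by omega) e2 e3 e4
      (hE.symm e1) with g | g
    · exact n2 g
    · exact n1 (hE.symm' g)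

/-- If the first sides had different lengths, the end of the shorter would be a vertex strictly
under the longer. -/
theorem fst_unique (hE : IsArcSystem n E) (h : IsQuad n E s a b c d)
    (h' : IsQuad n E s a' b' c' d') : a = a' := by
  have := numLeaves_pos a; have := numLeaves_pos a'
  refine hE.tree_unique (chords_iff.1 h.chords).1 (chords_iff.1 h'.chords).1 ?_
  rcases lt_trichotomy a.numLeaves a'.numLeaves with g | g | g
  · exact (not_between hE h' (h.rotate hE) (by omega) (by omega)).elim
  · exact g
  · exact (not_between hE h (h'.rotate hE) (by omega) (by omega)).elim

theorem unique (hE : IsArcSystem n E) (h : IsQuad n E s a b c d)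
    (h' : IsQuad n E s a' b' c' d') : a = a' ∧ b = b' ∧ c = c' ∧ d = d' := by
  obtain rfl := fst_unique hE h h'
  obtain rfl := fst_unique hE (h.rotate hE) (h'.rotate hE)
  obtain rfl := fst_unique hE ((h.rotate hE).rotate hE) ((h'.rotate hE).rotate hE)
  obtain rfl := fst_unique hE (((h.rotate hE).rotate hE).rotate hE)
    (((h'.rotate hE).rotate hE).rotate hE)
  simp

theorem of_add_mul (hE : IsArcSystem n E) (k : ℕ) (h : IsQuad n E (s + k * n) a b c d) :
    IsQuad n E s a b c d := by
  induction k with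
  | zero => simpa using h
  | succ k ih => exact ih (of_add hE (by convert h using 1; ring))

theorem add_mul (hE : IsArcSystem n E) (k : ℕ) (h : IsQuad n E s a b c d) :
    IsQuad n E (s + k * n) a b c d := by
  induction k with
  | zero => simpa using h
  | succ k ih => convert add hE ih using 1; ring

theorem cyclic_unique (hE : IsArcSystem n E) (h : IsQuad n E s a b c d)
    (h' : IsQuad n E s' a' b' c' d') :
    ((a, b, c, d) = (a', b', c', d') ∨ (b, c, d, a) = (a', b', c', d')) ∨
      (c, d, a, b) = (a', b', c', d') ∨ (d, a, b, c) = (a', b', c', d') := by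
  have hl := h.leaves
  have := numLeaves_pos a
  have hn : 0 < n := by omega
  -- Move `s'` into the period starting at `s`. Adding `s * n` first makes it at least `s`, so that
  -- the subtraction is not truncated.
  obtain ⟨u, hs, hu, hsu⟩ : ∃ u, IsQuad n E u a' b' c' d' ∧ s ≤ u ∧ u < s + n := by
    have h2 := h'.add_mul hE s
    have hle : s ≤ s' + s * n := by nlinarith
    refine ⟨s + (s' + s * n - s) % n, of_add_mul hE ((s' + s * n - s) / n) ?_, by omega,
      by have := Nat.mod_lt (s' + s * n - s) hn; omega⟩
    convert h2 using 1
    have := Nat.mod_add_div' (s' + s * n - s) n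
    omega
  have hr1 := h.rotate hE
  have hr2 := hr1.rotate hE
  have hr3 := hr2.rotate hE
  by_cases g0 : u = s
  · subst g0; obtain ⟨rfl, rfl, rfl, rfl⟩ := unique hE h hs; simp
  by_cases g1 : u = s + a.numLeaves
  · subst g1; obtain ⟨rfl, rfl, rfl, rfl⟩ := unique hE hr1 hs; simp
  by_cases g2 : u = s + a.numLeaves + b.numLeaves
  · subst g2; obtain ⟨rfl, rfl, rfl, rfl⟩ := unique hE hr2 hs; simp
  by_cases g3 : u = s + a.numLeaves + b.numLeaves + c.numLeaves
  · subst g3; obtain ⟨rfl, rfl, rfl, rfl⟩ := unique hE hr3 hs; simp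
  exfalso
  by_cases f1 : u < s + a.numLeaves
  · exact not_between hE h hs (by omega) f1
  by_cases f2 : u < s + a.numLeaves + b.numLeaves
  · exact not_between hE hr1 hs (by omega) f2
  by_cases f3 : u < s + a.numLeaves + b.numLeaves + c.numLeaves
  · exact not_between hE hr2 hs (by omega) f3
  · exact not_between hE hr3 hs (by omega) (by omega)

end IsQuad

/-! ### Chords of the polygon and their lifts -/

/-- The vertex `a` modulo `n` of the `n`-gon. -/
def vert (n : ℕ) [NeZero n] (a : ℕ) : Fin n := Fin.ofNat n a

/-- The chord which joins the vertices `a` and `b` modulo `n` of the `n`-gon. -/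
def chord (n : ℕ) [NeZero n] (a b : ℕ) : Sym2 (Fin n) := s(vert n a, vert n b)

theorem Crossing.symm {n : ℕ} {e f : Sym2 (Fin n)} (h : Crossing e f) : Crossing f e := by
  obtain ⟨a, c, b, d, h1, h2, h3, h⟩ := h
  exact ⟨a, c, b, d, h1, h2, h3, h.symm.imp And.symm And.symm⟩

section
variable {n : ℕ} [NeZero n]

theorem val_vert (a : ℕ) : (vert n a : ℕ) = a % n := rfl

theorem val_vert_of_lt {a : ℕ} (h : a < n) : (vert n a : ℕ) = a := Nat.mod_eq_of_lt h

theorem vert_val (x : Fin n) : vert n x = x := Fin.ext (Nat.mod_eq_of_lt x.2)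

theorem vert_eq_iff {a b : ℕ} : vert n a = vert n b ↔ a % n = b % n := by
  rw [Fin.ext_iff, val_vert, val_vert]

theorem vert_add_mul (a k : ℕ) : vert n (a + n * k) = vert n a := by
  rw [vert_eq_iff, Nat.add_mul_mod_self_left]

theorem vert_add (a : ℕ) : vert n (a + n) = vert n a := by
  rw [vert_eq_iff, Nat.add_mod_right]

theorem eq_of_vert_eq {a b : ℕ} (h : vert n a = vert n b) (h1 : a < b + n) (h2 : b < a + n) :
    a = b := by
  wlog hab : a ≤ b generalizing a b
  · exact (this h.symm h2 h1 (by omega)).symm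
  have h3 : n ∣ b - a := (Nat.modEq_iff_dvd' hab).1 (vert_eq_iff.1 h)
  have := Nat.eq_zero_of_dvd_of_lt h3 (by omega)
  omega

theorem exists_vert_eq (x : Fin n) (k : ℕ) : ∃ m, k ≤ m ∧ m < k + n ∧ vert n m = x := by
  have hn : 0 < n := Nat.pos_of_neZero n
  have hle : k ≤ x + n * k := by nlinarith
  refine ⟨k + (x + n * k - k) % n, by omega, by have := Nat.mod_lt (x + n * k - k) hn; omega, ?_⟩
  conv_rhs => rw [← vert_val x]
  rw [vert_eq_iff, Nat.add_mod_mod, Nat.add_sub_cancel' hle, Nat.add_mul_mod_self_left]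

theorem chord_comm (a b : ℕ) : chord n a b = chord n b a := Sym2.eq_swap

theorem chord_add_right (a b : ℕ) : chord n a (b + n) = chord n a b := by
  rw [chord, vert_add, chord]

theorem chord_add_left (a b : ℕ) : chord n (a + n) b = chord n a b := by
  rw [chord, vert_add, chord]

theorem chord_add_mul (a b k : ℕ) : chord n (a + n * k) (b + n * k) = chord n a b := by
  rw [chord, vert_add_mul, vert_add_mul, chord]

/-- In a window of length `n` only the two end points coincide modulo `n`. This causes the two
exceptional cases. -/
theorem chord_eq_chord {a b a' b' s : ℕ} (h : chord n a b = chord n a' b') (ha : s ≤ a)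
    (hab : a < b) (hb : b ≤ s + n) (ha' : s ≤ a') (hab' : a' < b') (hb' : b' ≤ s + n) :
    (a = a' ∧ b = b') ∨ (b = a' ∧ a = s ∧ b' = s + n) ∨ (a = b' ∧ a' = s ∧ b = s + n) := by
  rcases Sym2.eq_iff.1 h with ⟨h1, h2⟩ | ⟨h1, h2⟩
  · exact .inl ⟨eq_of_vert_eq h1 (by omega) (by omega), eq_of_vert_eq h2 (by omega) (by omega)⟩
  · by_cases c1 : a = s ∧ b' = s + n
    · obtain ⟨rfl, rfl⟩ := c1
      by_cases c2 : b = a + n ∧ a' = a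
      · omega
      · have := eq_of_vert_eq h2 (by omega) (by omega)
        omega
    · have h3 := eq_of_vert_eq h1 (by omega) (by omega)
      by_cases c2 : b = s + n ∧ a' = s
      · omega
      · have := eq_of_vert_eq h2 (by omega) (by omega)
        omega

theorem finRotate_pow_vert (i a : ℕ) :
    ((finRotate n) ^ i : Equiv.Perm (Fin n)) (vert n a) = vert n (a + i) := by
  induction i with
  | zero => rfl
  | succ i ih =>
    rw [pow_succ', Equiv.Perm.mul_apply, ih, finRotate_apply]
    apply Fin.ext
    rw [Fin.val_add, val_vert, val_vert, Fin.val_one', ← Nat.add_mod, add_assoc]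

theorem finRotate_vert (a : ℕ) : finRotate n (vert n a) = vert n (a + 1) := by
  simpa using finRotate_pow_vert (n := n) 1 a

theorem map_finRotate_pow_chord (i a b : ℕ) :
    Sym2.map ((finRotate n) ^ i : Equiv.Perm (Fin n)) (chord n a b) =
      chord n (a + i) (b + i) := by
  rw [chord, Sym2.map_mk, finRotate_pow_vert, finRotate_pow_vert, chord]

theorem crossing_of_lt {a b c d : ℕ} (h1 : a < c) (h2 : c < b) (h3 : b < d) (h4 : d < n) :
    Crossing (chord n a b) (chord n c d) := by
  refine ⟨vert n a, vert n c, vert n b, vert n d, ?_, ?_, ?_, .inl ⟨rfl, rfl⟩⟩ <;>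
    rw [Fin.lt_def, val_vert_of_lt (by omega), val_vert_of_lt (by omega)] <;> assumption

theorem crossing_chord {a b c d : ℕ} (h1 : a < c) (h2 : c < b) (h3 : b < d) (h4 : d < a + n) :
    Crossing (chord n a b) (chord n c d) := by
  have hn : 0 < n := Nat.pos_of_neZero n
  wlog ha : a < n generalizing a b c d
  · have hm := Nat.mod_add_div a n
    have hlt := Nat.mod_lt a hn
    have := this (a := a % n) (b := b - n * (a / n)) (c := c - n * (a / n))
      (d := d - n * (a / n)) (by omega) (by omega) (by omega) (by omega) (by omega)
    rw [← chord_add_mul (a % n) _ (a / n), ← chord_add_mul (c - _) _ (a / n)] at this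
    convert this using 2 <;> omega
  -- The end points that have passed `n` are reduced one at a time, from the largest down; each
  -- reduction rotates the alternating pattern cyclically.
  by_cases hd : d < n
  · exact crossing_of_lt h1 h2 h3 hd
  obtain ⟨d, rfl⟩ := Nat.exists_eq_add_of_le' (not_lt.1 hd)
  rw [chord_add_right]
  by_cases hb : b < n
  · rw [chord_comm c]
    exact (crossing_of_lt (by omega) (by omega) (by omega) (by omega)).symm
  obtain ⟨b, rfl⟩ := Nat.exists_eq_add_of_le' (not_lt.1 hb)
  rw [chord_add_right]
  by_cases hc : c < n
  · rw [chord_comm c, chord_comm a]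
    exact crossing_of_lt (by omega) (by omega) (by omega) (by omega)
  obtain ⟨c, rfl⟩ := Nat.exists_eq_add_of_le' (not_lt.1 hc)
  rw [chord_add_left, chord_comm a]
  exact (crossing_of_lt (by omega) (by omega) (by omega) (by omega)).symm

theorem exists_of_crossing_chord {k j : ℕ} {f : Sym2 (Fin n)} (hkj : k < j) (hj : j < k + n)
    (h : Crossing (chord n k j) f) :
    ∃ c d, k < c ∧ c < j ∧ j < d ∧ d < k + n ∧ f = chord n c d := by
  have hn : 0 < n := Nat.pos_of_neZero n
  wlog hk : k < n generalizing k j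
  · have hm := Nat.mod_add_div k n
    have hlt := Nat.mod_lt k hn
    obtain ⟨c, d, h1, h2, h3, h4, rfl⟩ := this (k := k % n) (j := j - n * (k / n)) (by omega)
      (by omega) (by rw [← chord_add_mul _ _ (k / n)]; convert h using 2 <;> omega) hlt
    exact ⟨c + n * (k / n), d + n * (k / n), by omega, by omega, by omega, by omega,
      (chord_add_mul _ _ _).symm⟩
  have eq_of : ∀ {x y : ℕ} {a b : Fin n}, x < n → y < n → chord n x y = s(a, b) →
      (x = a ∧ y = b) ∨ (x = b ∧ y = a) := by
    intro x y a b hx hy h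
    rcases Sym2.eq_iff.1 h with ⟨rfl, rfl⟩ | ⟨rfl, rfl⟩ <;>
      simp [val_vert_of_lt hx, val_vert_of_lt hy]
  have mk_eq : ∀ a b : Fin n, s(a, b) = chord n a b := fun a b => by
    rw [chord, vert_val, vert_val]
  obtain ⟨a, c, b, d, h1, h2, h3, h⟩ := h
  rw [Fin.lt_def] at h1 h2 h3
  have := d.2
  by_cases hjn : j < n
  · rcases h with ⟨h, rfl⟩ | ⟨h, rfl⟩
    · have := eq_of hk hjn h
      exact ⟨c, d, by omega, by omega, by omega, by omega, mk_eq _ _⟩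
    · have := eq_of hk hjn h
      exact ⟨b, a + n, by omega, by omega, by omega, by omega,
        by rw [mk_eq, chord_comm, chord_add_right]⟩
  · obtain ⟨j, rfl⟩ := Nat.exists_eq_add_of_le' (not_lt.1 hjn)
    rw [chord_add_right] at h
    rcases h with ⟨h, rfl⟩ | ⟨h, rfl⟩
    · have := eq_of hk (by omega) h
      exact ⟨d, c + n, by omega, by omega, by omega, by omega,
        by rw [mk_eq, chord_comm, chord_add_right]⟩
    · have := eq_of hk (by omega) h
      exact ⟨a + n, b + n, by omega, by omega, by omega, by omega,
        by rw [mk_eq, chord_add_right, chord_add_left]⟩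

theorem isDiagonal_chord {k j : ℕ} (h1 : k + 2 ≤ j) (h2 : j + 2 ≤ k + n) :
    IsDiagonal (chord n k j) := by
  constructor
  · intro h
    have := eq_of_vert_eq (n := n) (Sym2.mk_isDiag_iff.1 h) (by omega) (by omega)
    omega
  · rintro ⟨v, hv⟩
    obtain ⟨m, m1, m2, rfl⟩ := exists_vert_eq v k
    rw [finRotate_vert] at hv
    have := chord_eq_chord (n := n) (s := k) (b' := m + 1) hv le_rfl (by omega) (by omega) m1
      (by omega) (by omega)
    omega

theorem IsDiagonal.exists_chord {e : Sym2 (Fin n)} (h : IsDiagonal e) :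
    ∃ a b, a + 2 ≤ b ∧ b + 2 ≤ a + n ∧ b < n ∧ e = chord n a b := by
  induction e with | _ x y
  wlog hxy : x < y generalizing x y
  · rw [Sym2.eq_swap] at h ⊢
    exact this _ _ h (lt_of_le_of_ne (not_lt.1 hxy) fun h' => h.1 (Sym2.mk_isDiag_iff.2 h'))
  rw [Fin.lt_def] at hxy
  have hy := y.2
  have e : s(x, y) = chord n x y := by rw [chord, vert_val, vert_val]
  refine ⟨x, y, ?_, ?_, hy, e⟩
  · by_contra hne
    refine h.2 ⟨x, ?_⟩
    rw [← vert_val x, finRotate_vert, ← vert_val y, vert_val x]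
    congr 3
    omega
  · by_contra hne
    have e1 : vert n (y + 1) = x := by
      rw [show (y : ℕ) + 1 = x + n by omega, vert_add, vert_val]
    rw [← finRotate_vert, vert_val] at e1
    exact h.2 ⟨y, by rw [e1, Sym2.eq_swap]⟩

/-- The lifts to the natural numbers of the sides and diagonals of a dissection. -/
def arcs (Φ : Finset (Sym2 (Fin n))) (a b : ℕ) : Prop :=
  a < b ∧ b < a + n ∧ (b = a + 1 ∨ b + 1 = a + n ∨ chord n a b ∈ Φ)

variable {Φ : Finset (Sym2 (Fin n))}

theorem arcs_of_mem {a b : ℕ} (h1 : a < b) (h2 : b < a + n) (h : chord n a b ∈ Φ) : arcs Φ a b :=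
  ⟨h1, h2, .inr (.inr h)⟩

theorem mem_of_arcs {a b : ℕ} (h : arcs Φ a b) (h1 : a + 2 ≤ b) (h2 : b + 2 ≤ a + n) :
    chord n a b ∈ Φ := by
  obtain ⟨-, -, h | h | h⟩ := h
  · omega
  · omega
  · exact h

theorem IsDissection.arcs (hn : 2 ≤ n) (hΦ : IsDissection Φ) : IsArcSystem n (arcs Φ) where
  lt h := h.1
  lt_add h := h.2.1
  side a := ⟨by omega, by omega, .inl rfl⟩
  -- The arcs from `a` to `b` and from `b` to `a + n` lift the same chord; lengths `1` and `n - 1`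
  -- are exchanged, which is why `arcs` admits both.
  symm := by
    rintro a b ⟨h1, h2, h⟩
    refine ⟨h2, by omega, ?_⟩
    rw [chord_comm, chord_add_left]
    rcases h with h | h | h
    · exact .inr (.inl (by omega))
    · exact .inl (by omega)
    · exact .inr (.inr h)
  of_add := by
    rintro a b ⟨h1, h2, h⟩
    refine ⟨by omega, by omega, ?_⟩
    rw [chord_add_left, chord_add_right] at h
    exact h.imp (by omega) (Or.imp_left (by omega))
  noncrossing := by
    rintro a b c d hab hcd h1 h2 h3 h4
    exact hΦ.2 _ (mem_of_arcs hab (by omega) (by omega)) _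
      (mem_of_arcs hcd (by omega) (by omega)) (crossing_chord h1 h2 h3 h4)

theorem IsDissection.insert_chord (hΦ : IsDissection Φ) {k j : ℕ} (h1 : k + 2 ≤ j)
    (h2 : j + 2 ≤ k + n) (h : ∀ c d, k < c → c < j → j < d → d < k + n →
      ¬ PolygonDissection.arcs Φ c d) : IsDissection (insert (chord n k j) Φ) := by
  have key : ∀ f ∈ insert (chord n k j) Φ, ¬ Crossing (chord n k j) f := by
    intro f hf hc
    obtain ⟨c, d, g1, g2, g3, g4, rfl⟩ := exists_of_crossing_chord (by omega) (by omega) hc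
    rcases Finset.mem_insert.1 hf with hf | hf
    · have := chord_eq_chord (n := n) (s := k) hf (by omega) (by omega) (by omega) (by omega)
        (by omega) (by omega)
      omega
    · exact h c d g1 g2 g3 g4 (arcs_of_mem (by omega) (by omega) hf)
  constructor
  · intro e he
    rcases Finset.mem_insert.1 he with rfl | he
    · exact isDiagonal_chord h1 h2
    · exact hΦ.1 e he
  · intro e he f hf hc
    rcases Finset.mem_insert.1 he with rfl | he'
    · exact key f hf hc
    rcases Finset.mem_insert.1 hf with rfl | hf'
    · exact key e he hc.symm
    · exact hΦ.2 e he' f hf' hc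

theorem IsDissection.subset {n : ℕ} {Φ Ψ : Finset (Sym2 (Fin n))} (hΦ : IsDissection Φ)
    (h : Ψ ⊆ Φ) : IsDissection Ψ :=
  ⟨fun e he => hΦ.1 e (h he), fun e he f hf => hΦ.2 e (h he) f (h hf)⟩

/-! ### Triangulations as trees and the dissections obtained from forests -/

/-- A triangulation is a dissection to which no diagonal can be added. -/
def IsTriangulation {n : ℕ} (Φ : Finset (Sym2 (Fin n))) : Prop :=
  Maximal IsDissection Φ

/-- The apex is the last `k` before `j` joined to `i`. Nothing crosses the chord from `k` to `j`, so
maximality puts it into the triangulation. -/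
theorem IsTriangulation.exists_apex (hn : 2 ≤ n) (hΦ : IsTriangulation Φ) {i j : ℕ}
    (h : arcs Φ i j) (hij : i + 2 ≤ j) : ∃ k, i < k ∧ k < j ∧ arcs Φ i k ∧ arcs Φ k j := by
  have hE := hΦ.1.arcs hn
  classical
  let p : ℕ → Prop := fun k => k < j ∧ arcs Φ i k
  have hp1 : p (i + 1) := ⟨by omega, hE.side i⟩
  have hmax : ∀ m, p m → m ≤ Nat.findGreatest p j := fun m hm =>
    Nat.le_findGreatest hm.1.le hm
  obtain ⟨hkj, hik⟩ : p (Nat.findGreatest p j) := Nat.findGreatest_spec (by omega) hp1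
  have hk1 := hmax _ hp1
  generalize Nat.findGreatest p j = k at *
  have := hE.lt_add h
  refine ⟨k, by omega, hkj, hik, ?_⟩
  by_cases hk : j = k + 1
  · exact hk ▸ hE.side k
  refine arcs_of_mem hkj (by omega) ?_
  -- An arc crossing `k j` either crosses `i j`, or ends at `i + n` and contradicts the choice of
  -- `k`, or passes beyond `i + n` and crosses `i k`.
  have hins := hΦ.1.insert_chord (k := k) (j := j) (by omega) (by omega) fun c d h1 h2 h3 h4 hcd => by
    by_cases hd : d < i + n
    · exact hE.noncrossing h hcd (by omega) (by omega) h3 hd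
    rcases (not_lt.1 hd).eq_or_lt with rfl | hd
    · have := hmax c ⟨h2, hE.symm' hcd⟩
      omega
    · obtain ⟨d, rfl⟩ := Nat.exists_eq_add_of_le' (show n ≤ d by omega)
      exact hE.noncrossing hik (hE.symm' hcd) (by omega) (by omega) h1 (by omega)
  exact hΦ.2 hins (Finset.subset_insert _ _) (Finset.mem_insert_self _ _)

theorem IsTriangulation.exists_tree (hn : 2 ≤ n) (hΦ : IsTriangulation Φ) {i j : ℕ}
    (h : arcs Φ i j) :
    ∃ t : BinaryTree Unit, i + t.numLeaves = j ∧ ∀ p ∈ nodeChords t i, arcs Φ p.1 p.2 := by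
  induction hm : j - i using Nat.strong_induction_on generalizing i j with
  | _ m ih =>
    have := h.1
    by_cases hij : j = i + 1
    · exact ⟨.nil, by simp [hij], by simp [nodeChords]⟩
    obtain ⟨k, h1, h2, h3, h4⟩ := hΦ.exists_apex hn h (by omega)
    obtain ⟨l, rfl, hl⟩ := ih (k - i) (by omega) h3 rfl
    obtain ⟨r, rfl, hr⟩ := ih (j - (i + l.numLeaves)) (by omega) h4 rfl
    exact ⟨.node () l r, by simp [add_assoc],
      IsArcSystem.node_iff.2 ⟨by rwa [← add_assoc], hl, hr⟩⟩

/-- Two lifts could agree only as `(s, x)` and `(x, s + n)`. The first must lie over the first tree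
and the second beyond the second tree, so they share no end point `x` when there are three trees. -/
theorem chord_injOn_forestChords (F : List (BinaryTree Unit)) (s : ℕ) (h3 : 3 ≤ F.length)
    (hF : forestLeaves F = n) :
    Set.InjOn (fun p : ℕ × ℕ => chord n p.1 p.2) (forestChords F s : Set (ℕ × ℕ)) := by
  have key : ∀ {x y : ℕ}, (s, x) ∈ forestChords F s → (y, s + n) ∈ forestChords F s → x < y := by
    intro x y hx hy
    match F, h3 with
    | t :: u :: v :: F, _ =>
      have := numLeaves_pos t; have := numLeaves_pos u; have := numLeaves_pos v
      simp only [forestLeaves_cons] at hF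
      rw [forestChords, forestChords, Finset.mem_union, Finset.mem_union] at hx hy
      have hx' : x ≤ s + t.numLeaves := by
        rcases hx with hx | hx | hx
        · exact (nodeChords_bounds hx).2.2
        · have := nodeChords_bounds hx; simp only [] at this; omega
        · have := forestChords_bounds hx; simp only [] at this; omega
      rcases hy with hy | hy | hy
      · have := nodeChords_bounds hy; simp only [] at this; omega
      · have := nodeChords_bounds hy; simp only [] at this; omega
      · have := forestChords_bounds hy; simp only [] at this; omega
  rintro ⟨x, y⟩ hp ⟨x', y'⟩ hq h
  have b1 := forestChords_bounds hp
  have b2 := forestChords_bounds hq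
  simp only [] at b1 b2
  rw [hF] at b1 b2
  rcases chord_eq_chord (a := x) (b := y) (a' := x') (b' := y') h b1.1 (by omega) b1.2.2.1 b2.1 (by omega) b2.2.2.1 with
    ⟨rfl, rfl⟩ | ⟨rfl, rfl, rfl⟩ | ⟨rfl, rfl, rfl⟩
  · rfl
  · exact absurd (key hp hq) (lt_irrefl _)
  · exact absurd (key hq hp) (lt_irrefl _)

/-- The diagonals of a sequence of consecutive triangulated polygons, modulo `n`. -/
def forestDiagonals (n : ℕ) [NeZero n] (F : List (BinaryTree Unit)) (s : ℕ) :
    Finset (Sym2 (Fin n)) :=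
  (forestChords F s).image fun p => chord n p.1 p.2

theorem card_forestDiagonals (F : List (BinaryTree Unit)) (s : ℕ) (h3 : 3 ≤ F.length)
    (hF : forestLeaves F = n) : (forestDiagonals n F s).card + F.length = n := by
  rw [forestDiagonals, Finset.card_image_of_injOn (chord_injOn_forestChords F s h3 hF),
    card_forestChords, hF]

theorem forestDiagonals_subset {F : List (BinaryTree Unit)} {s : ℕ} (h3 : 3 ≤ F.length)
    (hF : forestLeaves F = n) (h : ∀ p ∈ forestChords F s, arcs Φ p.1 p.2) :
    forestDiagonals n F s ⊆ Φ := by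
  intro e he
  obtain ⟨p, hp, rfl⟩ := Finset.mem_image.1 he
  have := forestChords_bounds hp
  exact mem_of_arcs (h p hp) (by omega) (by omega)

theorem arcs_of_forestDiagonals_subset {F : List (BinaryTree Unit)} {s : ℕ} (h3 : 3 ≤ F.length)
    (hF : forestLeaves F = n) (h : forestDiagonals n F s ⊆ Φ) :
    ∀ p ∈ forestChords F s, arcs Φ p.1 p.2 := by
  intro p hp
  have := forestChords_bounds hp
  exact arcs_of_mem (by omega) (by omega) (h (Finset.mem_image_of_mem _ hp))

theorem permute_forestDiagonals (F : List (BinaryTree Unit)) (s i : ℕ) :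
    permute ((finRotate n) ^ i) (forestDiagonals n F s) = forestDiagonals n F (s + i) := by
  rw [permute, forestDiagonals, forestDiagonals, forestChords_add, Finset.image_image,
    Finset.image_image]
  congr 1
  funext p
  exact map_finRotate_pow_chord _ _ _

theorem isDissection_forestDiagonals (F : List (BinaryTree Unit)) (h3 : 3 ≤ F.length)
    (hF : forestLeaves F = n) : IsDissection (forestDiagonals n F 0) := by
  constructor
  · intro e he
    obtain ⟨p, hp, rfl⟩ := Finset.mem_image.1 he
    have := forestChords_bounds hp
    exact isDiagonal_chord (by omega) (by omega)
  · intro e he f hf hc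
    obtain ⟨⟨x, y⟩, hp, rfl⟩ := Finset.mem_image.1 he
    obtain ⟨⟨x', y'⟩, hq, rfl⟩ := Finset.mem_image.1 hf
    have b1 := forestChords_bounds hp
    have b2 := forestChords_bounds hq
    have n1 := forestChords_noncrossing hp hq
    have n2 := forestChords_noncrossing hq hp
    simp only [] at b1 b2 n1 n2 hc
    -- Compares a lift in `[0, n]` with the ordered pair of vertices; they differ only if the lift
    -- ends at `n`, which represents the vertex `0`.
    have eq_of : ∀ {u v : ℕ} {a b : Fin n}, u + 2 ≤ v → v ≤ n → chord n u v = s(a, b) → a < b →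
        (u = a ∧ v = b) ∨ (u = b ∧ (a : ℕ) = 0 ∧ v = n) := by
      intro u v a b h1 h2 h hab
      rw [Fin.lt_def] at hab
      have := b.2
      have := chord_eq_chord (n := n) (s := 0) (a' := a) (b' := b)
        (h.trans (by rw [chord, vert_val, vert_val])) (by omega) (by omega) (by omega) (by omega)
        (by omega) (by omega)
      omega
    obtain ⟨a, c, b, d, h1, h2, h3, h⟩ := hc
    have hd := d.2
    have hac := h1.trans h2
    have hcd := h2.trans h3
    rcases h with ⟨ha, hb⟩ | ⟨ha, hb⟩
    · have := eq_of (by omega) (by omega) ha hac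
      have := eq_of (by omega) (by omega) hb hcd
      rw [Fin.lt_def] at h1 h2 h3
      omega
    · have := eq_of (by omega) (by omega) ha hcd
      have := eq_of (by omega) (by omega) hb hac
      rw [Fin.lt_def] at h1 h2 h3
      omega

end

/-! ### Numbers of diagonals and existence of the quadrilateral -/

section
variable {n : ℕ} [NeZero n] {Φ : Finset (Sym2 (Fin n))}

/-- The triangle on the side from `n - 1` to `0` exhibits the triangulation as a forest of three
trees, the third being that side itself, and a forest of three trees with `n` leaves has `n - 3`
diagonals. -/
theorem IsTriangulation.card_add_three (hn : 3 ≤ n) (hΦ : IsTriangulation Φ) :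
    Φ.card + 3 = n := by
  have hE := hΦ.1.arcs (by omega)
  have h0 : PolygonDissection.arcs Φ 0 (n - 1) := ⟨by omega, by omega, .inr (.inl (by omega))⟩
  obtain ⟨k, h1, h2, h3, h4⟩ := hΦ.exists_apex (by omega) h0 (by omega)
  obtain ⟨l, rfl, hl⟩ := hΦ.exists_tree (by omega) h3
  obtain ⟨r, hr', hr⟩ := hΦ.exists_tree (by omega) h4
  have hF : forestLeaves [l, r, .nil] = n := by simp; omega
  have hroot : ∀ p ∈ nodeChords (.node () l r) 0, PolygonDissection.arcs Φ p.1 p.2 :=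
    IsArcSystem.node_iff.2 ⟨by convert h0 using 1; omega, hl, hr⟩
  have : forestDiagonals n [l, r, .nil] 0 = Φ := by
    apply (forestDiagonals_subset (by simp) hF _).antisymm
    · intro e he
      obtain ⟨a, b, hab, hba, hb, rfl⟩ := (hΦ.1.1 e he).exists_chord
      rcases hE.mem_nodeChords hroot (arcs_of_mem (by omega) (by omega) he) (Nat.zero_le _)
        (by simp; omega) with h | h
      · omega
      · refine Finset.mem_image.2 ⟨(a, b), ?_, rfl⟩
        simp only [nodeChords, Finset.mem_insert, Finset.mem_union, Prod.mk.injEq] at h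
        simp only [forestChords, Finset.mem_union]
        rcases h with h | h | h
        · omega
        · exact .inl h
        · exact .inr (.inl h)
    · simp only [forestChords, nodeChords, Finset.mem_union, Finset.notMem_empty, or_false]
      rintro p (hp | hp)
      · exact hl p hp
      · exact hr p hp
  have hc := card_forestDiagonals [l, r, .nil] 0 (by simp) hF
  rwa [this] at hc

theorem IsDissection.exists_triangulation {n : ℕ} {Φ : Finset (Sym2 (Fin n))}
    (hΦ : IsDissection Φ) : ∃ Ψ, Φ ⊆ Ψ ∧ IsTriangulation Ψ :=
  Finite.exists_le_maximal hΦ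

theorem IsDissection.card_add_three_le (hn : 3 ≤ n) (hΦ : IsDissection Φ) : Φ.card + 3 ≤ n := by
  obtain ⟨Ψ, hsub, hΨ⟩ := hΦ.exists_triangulation
  have := hΨ.card_add_three hn
  have := Finset.card_le_card hsub
  omega

theorem IsDissection.isTriangulation_iff (hn : 3 ≤ n) (hΦ : IsDissection Φ) :
    IsTriangulation Φ ↔ Φ.card + 3 = n := by
  refine ⟨fun h => h.card_add_three hn, fun h => ?_⟩
  obtain ⟨Ψ, hsub, hΨ⟩ := hΦ.exists_triangulation
  have := hΨ.card_add_three hn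
  rwa [Finset.eq_of_subset_of_card_le hsub (by omega)]

theorem IsDissection.exists_insert (hn : 3 ≤ n) (hΦ : IsDissection Φ) (h : Φ.card + 3 < n) :
    ∃ e ∉ Φ, IsDissection (insert e Φ) := by
  obtain ⟨Ψ, hsub, hΨ⟩ := hΦ.exists_triangulation
  have := hΨ.card_add_three hn
  obtain ⟨e, he, he'⟩ := Finset.exists_mem_notMem_of_card_lt_card (s := Φ) (t := Ψ) (by omega)
  exact ⟨e, he', hΨ.1.subset (Finset.insert_subset he hsub)⟩

/-- A diagonal of the quadrilateral would merge two neighbouring trees into one. The resulting three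
trees would give `n - 3` diagonals in a set of size `n - 4`. -/
theorem isQuad_of_chords (hcard : Φ.card + 4 = n) {s : ℕ} {a b c d : BinaryTree Unit}
    (hl : a.numLeaves + b.numLeaves + c.numLeaves + d.numLeaves = n)
    (h : ∀ p ∈ forestChords [a, b, c, d] s, arcs Φ p.1 p.2) :
    IsQuad n (arcs Φ) s a b c d := by
  have key : ∀ F : List (BinaryTree Unit), F.length = 3 → forestLeaves F = n →
      ∀ s, ¬ ∀ p ∈ forestChords F s, arcs Φ p.1 p.2 := by
    intro F h3 hF s h
    have h1 := Finset.card_le_card (forestDiagonals_subset h3.ge hF h)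
    have h2 := card_forestDiagonals F s h3.ge hF
    omega
  obtain ⟨ha, hb, hc, hd⟩ := IsQuad.chords_iff.1 h
  refine ⟨hl, h, fun h' => ?_, fun h' => ?_⟩
  · refine key [.node () a b, c, d] (by simp) (by simp; omega) s ?_
    simp only [forestChords, Finset.mem_union, or_imp, forall_and, numLeaves]
    refine ⟨IsArcSystem.node_iff.2 ⟨by rwa [← add_assoc], ha, hb⟩, ?_, ?_, by simp⟩
    · rwa [← add_assoc]
    · rwa [← add_assoc]
  · refine key [a, .node () b c, d] (by simp) (by simp; omega) s ?_
    simp only [forestChords, Finset.mem_union, or_imp, forall_and, numLeaves]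
    refine ⟨ha, IsArcSystem.node_iff.2 ⟨by rwa [← add_assoc], hb, hc⟩, ?_, by simp⟩
    rwa [← add_assoc]

theorem eq_forestDiagonals (hcard : Φ.card + 4 = n) {s : ℕ} {a b c d : BinaryTree Unit}
    (h : IsQuad n (arcs Φ) s a b c d) : Φ = forestDiagonals n [a, b, c, d] s := by
  have hF : forestLeaves [a, b, c, d] = n := by have := h.leaves; simp; omega
  have := card_forestDiagonals [a, b, c, d] s (by simp) hF
  simp only [List.length_cons, List.length_nil] at this
  exact (Finset.eq_of_subset_of_card_le (forestDiagonals_subset (by simp) hF h.chords)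
    (by omega)).symm

theorem isQuad_forestDiagonals {s : ℕ} {a b c d : BinaryTree Unit}
    (hl : a.numLeaves + b.numLeaves + c.numLeaves + d.numLeaves = n) :
    IsQuad n (arcs (forestDiagonals n [a, b, c, d] s)) s a b c d := by
  have hF : forestLeaves [a, b, c, d] = n := by simp; omega
  exact isQuad_of_chords (card_forestDiagonals [a, b, c, d] s (by simp) hF) hl
    (arcs_of_forestDiagonals_subset (by simp) hF subset_rfl)

/-- Add one diagonal to obtain a triangulation; the two triangles on either side of it form the
quadrilateral. -/
theorem IsDissection.exists_isQuad (hΦ : IsDissection Φ) (hcard : Φ.card + 4 = n) :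
    ∃ s a b c d, IsQuad n (PolygonDissection.arcs Φ) s a b c d := by
  obtain ⟨e, he, hins⟩ := hΦ.exists_insert (by omega) (by omega)
  have hT : IsTriangulation (insert e Φ) := by
    rw [hins.isTriangulation_iff (by omega), Finset.card_insert_of_notMem he]
    omega
  obtain ⟨i, j, hij, hji, hj, rfl⟩ := (hins.1 e (Finset.mem_insert_self _ _)).exists_chord
  have hE := hins.arcs (by omega)
  have e1 : PolygonDissection.arcs (insert (chord n i j) Φ) i j :=
    arcs_of_mem (by omega) (by omega) (Finset.mem_insert_self _ _)
  obtain ⟨k, k1, k2, k3, k4⟩ := hT.exists_apex (by omega) e1 hij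
  obtain ⟨l, l1, l2, l3, l4⟩ := hT.exists_apex (by omega) (hE.symm e1) (by omega)
  obtain ⟨a, rfl, ha⟩ := hT.exists_tree (by omega) k3
  obtain ⟨b, rfl, hb⟩ := hT.exists_tree (by omega) k4
  obtain ⟨c, rfl, hc⟩ := hT.exists_tree (by omega) l3
  obtain ⟨d, hd', hd⟩ := hT.exists_tree (by omega) l4
  have hn : a.numLeaves + b.numLeaves + c.numLeaves + d.numLeaves = n := by omega
  have hF : forestLeaves [a, b, c, d] = n := by simp; omega
  refine ⟨i, a, b, c, d, isQuad_of_chords hcard hn fun p hp => ?_⟩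
  have hb0 := forestChords_bounds hp
  rw [hF] at hb0
  simp only [List.length_cons, List.length_nil] at hb0
  have hmem := mem_of_arcs (IsQuad.chords_iff.2 ⟨ha, hb, hc, hd⟩ p hp) (by omega) (by omega)
  -- The added diagonal spans two of the four trees on either side, so it is not a chord over any
  -- single tree.
  refine arcs_of_mem (by omega) (by omega) (Finset.mem_of_mem_insert_of_ne hmem fun heq => ?_)
  have hp' := hp
  simp only [forestChords, Finset.mem_union, Finset.notMem_empty, or_false] at hp'
  have hw := chord_eq_chord (s := i) heq (by omega) (by omega) (by omega) le_rfl (by omega)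
    (by omega)
  rcases hp' with h | h | h | h <;> have := nodeChords_bounds h <;> omega

end

/-! ### Rotation classes as orbits of quadruples of trees -/

/-- The cyclic sequences of four binary trees with `n` leaves in total. -/
abbrev TreeQuadruple (n : ℕ) : Type :=
  {f : ZMod 4 → BinaryTree Unit // ∑ x, (f x).numLeaves = n}

instance instMulActionTreeQuadruple (n : ℕ) :
    MulAction (Multiplicative (ZMod 4)) (TreeQuadruple n) where
  smul g f := ⟨fun x => f.1 (x + g.toAdd),
    (Equiv.sum_comp (Equiv.addRight g.toAdd) fun x => (f.1 x).numLeaves).trans f.2⟩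
  one_smul f := Subtype.ext (funext fun x => congrArg f.1 (add_zero x))
  mul_smul g h f := Subtype.ext (funext fun x => congrArg f.1 (by
    rw [toAdd_mul, add_comm g.toAdd, add_assoc, add_comm h.toAdd]))

theorem smul_treeQuadruple_apply {n : ℕ} (g : Multiplicative (ZMod 4)) (f : TreeQuadruple n)
    (x : ZMod 4) : (g • f).1 x = f.1 (x + g.toAdd) := rfl

theorem sum_zmod_four (f : ZMod 4 → ℕ) : ∑ x, f x = f 0 + f 1 + f 2 + f 3 :=
  Fin.sum_univ_four f

section
variable {n : ℕ}

/-- The list of the four trees. -/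
def TreeQuadruple.toList (f : TreeQuadruple n) : List (BinaryTree Unit) :=
  [f.1 0, f.1 1, f.1 2, f.1 3]

theorem TreeQuadruple.leaves (f : TreeQuadruple n) :
    (f.1 0).numLeaves + (f.1 1).numLeaves + (f.1 2).numLeaves + (f.1 3).numLeaves = n :=
  (sum_zmod_four _).symm.trans f.2

theorem TreeQuadruple.forestLeaves_toList (f : TreeQuadruple n) :
    forestLeaves f.toList = n := by
  have := f.leaves
  simp [TreeQuadruple.toList]
  omega

theorem IsQuad.exists_smul {E : ℕ → ℕ → Prop} (hE : IsArcSystem n E) {s : ℕ}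
    {f : TreeQuadruple n} (h : IsQuad n E s (f.1 0) (f.1 1) (f.1 2) (f.1 3))
    (g : Multiplicative (ZMod 4)) :
    ∃ s', IsQuad n E s' ((g • f).1 0) ((g • f).1 1) ((g • f).1 2) ((g • f).1 3) := by
  have h1 := h.rotate hE
  have h2 := h1.rotate hE
  have h3 := h2.rotate hE
  simp only [smul_treeQuadruple_apply]
  generalize g.toAdd = k
  fin_cases k
  · exact ⟨_, h⟩
  · exact ⟨_, h1⟩
  · exact ⟨_, h2⟩
  · exact ⟨_, h3⟩

theorem exists_smul_eq {f f' : TreeQuadruple n}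
    (h : ((f.1 0, f.1 1, f.1 2, f.1 3) = (f'.1 0, f'.1 1, f'.1 2, f'.1 3) ∨
      (f.1 1, f.1 2, f.1 3, f.1 0) = (f'.1 0, f'.1 1, f'.1 2, f'.1 3)) ∨
      (f.1 2, f.1 3, f.1 0, f.1 1) = (f'.1 0, f'.1 1, f'.1 2, f'.1 3) ∨
      (f.1 3, f.1 0, f.1 1, f.1 2) = (f'.1 0, f'.1 1, f'.1 2, f'.1 3)) :
    ∃ g : Multiplicative (ZMod 4), g • f = f' := by
  have key : ∀ k : ZMod 4, (f.1 k, f.1 (1 + k), f.1 (2 + k), f.1 (3 + k)) =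
      (f'.1 0, f'.1 1, f'.1 2, f'.1 3) → ∃ g : Multiplicative (ZMod 4), g • f = f' := by
    intro k hk
    simp only [Prod.mk.injEq] at hk
    refine ⟨Multiplicative.ofAdd k, Subtype.ext (funext fun x => ?_)⟩
    rw [smul_treeQuadruple_apply, toAdd_ofAdd]
    fin_cases x
    · exact (congrArg f.1 (zero_add k)).trans hk.1
    · exact hk.2.1
    · exact hk.2.2.1
    · exact hk.2.2.2
  rcases h with (h | h) | h | h
  · exact key 0 h
  · exact key 1 h
  · exact key 2 h
  · exact key 3 h

variable [NeZero n]

/-- The almost-triangulation in which the quadrilateral with a vertex at `0` has its sides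
glued to the triangulated polygons given by a quadruple of trees. -/
def almostTriangulation (f : TreeQuadruple n) : kDissections n (n - 4) :=
  ⟨⟨forestDiagonals n f.toList 0,
    isDissection_forestDiagonals f.toList (by simp [TreeQuadruple.toList]) f.forestLeaves_toList⟩,
    Nat.eq_sub_of_add_eq (card_forestDiagonals f.toList 0 (by simp [TreeQuadruple.toList])
      f.forestLeaves_toList)⟩

/-- The bijection is induced by `almostTriangulation`. It is well defined since shifting the
quadruple only changes the starting vertex, injective by `IsQuad.cyclic_unique`, and surjective by
`IsDissection.exists_isQuad`. -/
theorem card_orbits_kDissections (hn : 4 ≤ n) :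
    Nat.card (MulAction.orbitRel.Quotient (Rotations n) (kDissections n (n - 4))) =
      Nat.card (MulAction.orbitRel.Quotient (Multiplicative (ZMod 4)) (TreeQuadruple n)) := by
  have hcard : ∀ Φ : kDissections n (n - 4), Φ.1.1.card + 4 = n := fun Φ => by
    have : Φ.1.1.card = n - 4 := Φ.2
    omega
  have hquad : ∀ f : TreeQuadruple n,
      IsQuad n (arcs (almostTriangulation f).1.1) 0 (f.1 0) (f.1 1) (f.1 2) (f.1 3) :=
    fun f => isQuad_forestDiagonals f.leaves
  have hrot : ∀ (f : TreeQuadruple n) (i : ℕ) (hi : (finRotate n) ^ i ∈ Rotations n),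
      ((⟨(finRotate n) ^ i, hi⟩ : Rotations n) • almostTriangulation f).1.1 =
        forestDiagonals n f.toList i := by
    intro f i hi
    exact (permute_forestDiagonals f.toList 0 i).trans (by rw [zero_add])
  have horb : ∀ (Φ : kDissections n (n - 4)) (f : TreeQuadruple n) (s : ℕ),
      IsQuad n (arcs Φ.1.1) s (f.1 0) (f.1 1) (f.1 2) (f.1 3) →
      Φ ∈ MulAction.orbit (Rotations n) (almostTriangulation f) := by
    intro Φ f s h
    refine ⟨⟨(finRotate n) ^ s, Subgroup.npow_mem_zpowers _ _⟩, ?_⟩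
    apply Subtype.ext
    apply Subtype.ext
    exact (hrot f s _).trans (eq_forestDiagonals (hcard Φ) h).symm
  symm
  refine Nat.card_eq_of_bijective (Quotient.map' almostTriangulation ?_) ⟨?_, ?_⟩
  · rintro _ f ⟨g, rfl⟩
    obtain ⟨s, hs⟩ := (hquad f).exists_smul ((almostTriangulation f).1.2.arcs (by omega)) g
    exact (MulAction.orbitRel _ _).symm (horb _ _ _ hs)
  · rintro ⟨f⟩ ⟨f'⟩ h
    obtain ⟨⟨g, hg⟩, hg'⟩ := Quotient.eq''.1 h
    obtain ⟨i, rfl⟩ := exists_pow_of_mem hg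
    have h1 : (almostTriangulation f).1.1 = forestDiagonals n f'.toList i := by
      rw [← hrot f' i hg]
      exact congrArg (fun Φ => Φ.1.1) hg'.symm
    have h2 : IsQuad n (arcs (almostTriangulation f).1.1) i
        (f'.1 0) (f'.1 1) (f'.1 2) (f'.1 3) := by
      rw [h1]
      exact isQuad_forestDiagonals f'.leaves
    obtain ⟨g, hg⟩ := exists_smul_eq
      (IsQuad.cyclic_unique ((almostTriangulation f).1.2.arcs (by omega)) (hquad f) h2)
    exact Quotient.sound' ((MulAction.orbitRel _ _).symm ⟨g, hg⟩)
  · rintro ⟨Φ⟩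
    obtain ⟨s, a, b, c, d, h⟩ := Φ.1.2.exists_isQuad (hcard Φ)
    let f : TreeQuadruple n := ⟨(![a, b, c, d] : Fin 4 → BinaryTree Unit),
      (sum_zmod_four _).trans h.leaves⟩
    exact ⟨Quotient.mk'' f, Quotient.sound' ((MulAction.orbitRel _ _).symm (horb Φ f s h))⟩

/-! ### Edges of the associahedron -/

/-- Height one means not minimal, with only minimal faces below. Minimal faces are the
triangulations, and any dissection with fewer than `n - 3` diagonals can be enlarged by a single
one. -/
theorem faceDim_eq_one_iff (hn : 4 ≤ n) (F : AssociahedronFace n) :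
    faceDim F = 1 ↔ (OrderDual.ofDual F).1.card = n - 4 := by
  have hmin : ∀ G : AssociahedronFace n, IsMin G ↔ (OrderDual.ofDual G).1.card + 3 = n := by
    intro G
    rw [← (OrderDual.ofDual G).2.isTriangulation_iff (by omega)]
    constructor
    · intro h
      exact ⟨(OrderDual.ofDual G).2, fun Ψ hΨ hle => h (b := OrderDual.toDual ⟨Ψ, hΨ⟩) hle⟩
    · intro h H hle
      exact h.2 (OrderDual.ofDual H).2 hle
  have hlt : ∀ {G H : AssociahedronFace n}, G < H →
      (OrderDual.ofDual H).1.card < (OrderDual.ofDual G).1.card := fun h =>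
    Finset.card_lt_card h
  -- The criterion for a finite height presupposes finiteness; the number of missing diagonals, up
  -- to a constant, is a strictly monotone bound.
  have hfin : Order.height F < ⊤ := by
    have hmono : StrictMono fun G : AssociahedronFace n => n - (OrderDual.ofDual G).1.card := by
      intro G H h
      have := hlt h
      have := (OrderDual.ofDual G).2.card_add_three_le (by omega)
      simp only []
      omega
    refine (Order.height_le_height_apply_of_strictMono _ hmono F).trans_lt ?_
    rw [Order.height_nat]
    exact ENat.natCast_lt_top _
  have hF := (OrderDual.ofDual F).2.card_add_three_le (by omega)
  have h1 := Order.height_eq_coe_iff (x := F) (n := 1)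
  rw [faceDim]
  simp only [Nat.cast_one, hfin, true_and, one_ne_zero, false_or, tsub_self,
    Order.height_eq_zero, Order.lt_one_iff, hmin] at h1
  rw [h1]
  constructor
  · rintro ⟨⟨G, hG, hG'⟩, hall⟩
    have := hlt hG
    by_contra hne
    obtain ⟨e, he, hins⟩ := (OrderDual.ofDual F).2.exists_insert (by omega) (by omega)
    have := hall (OrderDual.toDual ⟨_, hins⟩) (Finset.ssubset_insert he)
    rw [OrderDual.ofDual_toDual, Finset.card_insert_of_notMem he] at this
    omega
  · intro h
    have hall : ∀ G < F, (OrderDual.ofDual G).1.card + 3 = n := fun G hG => by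
      have := (OrderDual.ofDual G).2.card_add_three_le (by omega)
      have := hlt hG
      omega
    obtain ⟨e, he, hins⟩ := (OrderDual.ofDual F).2.exists_insert (by omega) (by omega)
    have hins' : OrderDual.toDual (⟨_, hins⟩ : Dissection n) < F := Finset.ssubset_insert he
    exact ⟨⟨_, hins', hall _ hins'⟩, hall⟩

theorem card_orbits_associahedronEdges (hn : 4 ≤ n) :
    Nat.card (MulAction.orbitRel.Quotient (Rotations n) (associahedronEdges n)) =
      Nat.card (MulAction.orbitRel.Quotient (Rotations n) (kDissections n (n - 4))) := by
  let e : associahedronEdges n ≃ kDissections n (n - 4) :=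
    OrderDual.ofDual.subtypeEquiv fun F => faceDim_eq_one_iff hn F
  refine Nat.card_congr (Quotient.congr e fun F G => ?_)
  refine exists_congr fun g => ?_
  exact (e.injective.eq_iff (a := g • G) (b := F)).symm

end

/-! ### Catalan numbers and Burnside's lemma -/

theorem card_numNodes_eq (k : ℕ) :
    Nat.card {t : BinaryTree Unit // t.numNodes = k} = catalan k := by
  rw [← treesOfNumNodesEq_card_eq_catalan, ← Fintype.card_coe, ← Nat.card_eq_fintype_card]
  exact Nat.card_congr (Equiv.subtypeEquivRight fun t => mem_treesOfNumNodesEq.symm)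

theorem add_two_mul_catalan_succ (k : ℕ) :
    (k + 2) * catalan (k + 1) = 2 * (2 * k + 1) * catalan k := by
  have h1 := succ_mul_catalan_eq_centralBinom k
  have h2 := succ_mul_catalan_eq_centralBinom (k + 1)
  have h3 := Nat.succ_mul_centralBinom_succ k
  rw [← h1, ← h2] at h3
  refine Nat.eq_of_mul_eq_mul_left (show 0 < k + 1 by omega) ?_
  linear_combination h3

theorem catalanOrZero_natCast (k : ℕ) : catalanOrZero k = catalan k := by
  rw [catalanOrZero, Nat.floor_natCast, if_pos rfl, ← Nat.centralBinom_eq_two_mul_choose,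
    ← succ_mul_catalan_eq_centralBinom]
  have : (k : ℚ) + 1 ≠ 0 := by positivity
  push_cast
  field_simp

/-- If `n / d` is not a positive integer there are no such trees, and this is exactly when the
convention `C_x = 0` applies. -/
theorem card_mul_leaves_eq {d : ℕ} (hd : 0 < d) (n : ℕ) :
    (Nat.card {t : BinaryTree Unit // d * (t.numNodes + 1) = n} : ℚ) =
      catalanOrZero ((n : ℚ) / d - 1) := by
  have hd' : (d : ℚ) ≠ 0 := by positivity
  by_cases h : ∃ k, d * (k + 1) = n
  · obtain ⟨k, rfl⟩ := h
    have e : ((d * (k + 1) : ℕ) : ℚ) / d - 1 = k := by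
      push_cast
      field_simp
      ring
    rw [e, catalanOrZero_natCast, ← card_numNodes_eq]
    congr 1
    refine Nat.card_congr (Equiv.subtypeEquivRight fun t => ?_)
    rw [Nat.mul_right_inj hd.ne', Nat.add_right_cancel_iff]
  · have : IsEmpty {t : BinaryTree Unit // d * (t.numNodes + 1) = n} :=
      ⟨fun t => h ⟨_, t.2⟩⟩
    rw [Nat.card_of_isEmpty, catalanOrZero, if_neg, Nat.cast_zero]
    intro hx
    refine h ⟨⌊(n : ℚ) / d - 1⌋₊, ?_⟩
    generalize ⌊(n : ℚ) / d - 1⌋₊ = m at hx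
    have : (d : ℚ) * (m + 1) = n := by
      rw [← hx]
      field_simp
      ring
    exact_mod_cast this

/-- Gluing four trees, respectively one tree and an empty one, below a common root. -/
def glue (m : ℕ) : TreeQuadruple (m + 4) ⊕ ({t : BinaryTree Unit // t.numNodes = m + 2} ⊕
    {t : BinaryTree Unit // t.numNodes = m + 2}) → {t : BinaryTree Unit // t.numNodes = m + 3}
  | .inl f => ⟨.node () (.node () (f.1 0) (f.1 1)) (.node () (f.1 2) (f.1 3)), by
      have := f.leaves
      simp only [numLeaves_eq_numNodes_succ] at this
      simp only [numNodes]
      omega⟩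
  | .inr (.inl t) => ⟨.node () .nil t.1, by have := t.2; simp only [numNodes]; omega⟩
  | .inr (.inr t) => ⟨.node () t.1 .nil, by have := t.2; simp only [numNodes]; omega⟩

theorem TreeQuadruple.ext' {n : ℕ} {f g : TreeQuadruple n} (h0 : f.1 0 = g.1 0)
    (h1 : f.1 1 = g.1 1) (h2 : f.1 2 = g.1 2) (h3 : f.1 3 = g.1 3) : f = g := by
  refine Subtype.ext (funext fun x => ?_)
  fin_cases x
  · exact h0
  · exact h1
  · exact h2
  · exact h3

/-- A tree with at least three nodes has at most one empty subtree at its root. If neither is empty,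
the four grandchildren form the quadruple. -/
theorem glue_bijective (m : ℕ) : Function.Bijective (glue m) := by
  constructor
  · rintro (f | ⟨t, ht⟩ | ⟨t, ht⟩) (g | ⟨u, hu⟩ | ⟨u, hu⟩) h
    all_goals simp only [glue, Subtype.mk.injEq, node.injEq, true_and, reduceCtorEq, false_and,
      and_false, and_true] at h
    · rw [TreeQuadruple.ext' h.1.1 h.1.2 h.2.1 h.2.2]
    · subst h; rfl
    · obtain ⟨rfl, rfl⟩ := h; simp at ht
    · obtain ⟨rfl, rfl⟩ := h; simp at ht
    · subst h; rfl
  · rintro ⟨t, ht⟩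
    match t, ht with
    | .node _ .nil u, ht => exact ⟨.inr (.inl ⟨u, by simp only [numNodes] at ht; omega⟩), rfl⟩
    | .node _ (.node _ a b) .nil, ht =>
      exact ⟨.inr (.inr ⟨.node () a b, by simp only [numNodes] at ht ⊢; omega⟩), rfl⟩
    | .node _ (.node _ a b) (.node _ c d), ht =>
      exact ⟨.inl ⟨(![a, b, c, d] : Fin 4 → BinaryTree Unit), (sum_zmod_four _).trans (by
        change a.numLeaves + b.numLeaves + c.numLeaves + d.numLeaves = m + 4
        simp only [numLeaves_eq_numNodes_succ]
        simp only [numNodes] at ht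
        omega)⟩, rfl⟩

instance finite_numNodes_eq (k : ℕ) : Finite {t : BinaryTree Unit // t.numNodes = k} :=
  Finite.of_equiv (treesOfNumNodesEq k)
    (Equiv.subtypeEquivRight fun _ => mem_treesOfNumNodesEq)

instance finite_treeQuadruple (m : ℕ) : Finite (TreeQuadruple (m + 4)) :=
  Finite.of_injective (fun f => glue m (.inl f))
    ((glue_bijective m).1.comp Sum.inl_injective)

theorem card_treeQuadruple (m : ℕ) :
    Nat.card (TreeQuadruple (m + 4)) + 2 * catalan (m + 2) = catalan (m + 3) := by
  have h := Nat.card_eq_of_bijective _ (glue_bijective m)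
  rw [Nat.card_sum, Nat.card_sum, card_numNodes_eq, card_numNodes_eq] at h
  omega

theorem mem_fixedBy_iff {n : ℕ} (k : ZMod 4) (f : TreeQuadruple n) :
    f ∈ MulAction.fixedBy (TreeQuadruple n) (Multiplicative.ofAdd k) ↔
      ∀ x, f.1 (x + k) = f.1 x := by
  rw [MulAction.mem_fixedBy, Subtype.ext_iff, funext_iff]
  rfl

theorem card_fixedBy_zero (n : ℕ) :
    Nat.card (MulAction.fixedBy (TreeQuadruple n) (Multiplicative.ofAdd (0 : ZMod 4))) =
      Nat.card (TreeQuadruple n) :=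
  Nat.card_congr (Equiv.subtypeUnivEquiv fun f => (mem_fixedBy_iff _ _).2 fun x => by
    rw [add_zero])

theorem card_fixedBy_of_const {n : ℕ} {k : ZMod 4}
    (hk : ∀ f : ZMod 4 → BinaryTree Unit, (∀ x, f (x + k) = f x) ↔ ∀ x, f x = f 0) :
    Nat.card (MulAction.fixedBy (TreeQuadruple n) (Multiplicative.ofAdd k)) =
      Nat.card {t : BinaryTree Unit // 4 * (t.numNodes + 1) = n} := by
  refine Nat.card_eq_of_bijective (fun f => ⟨f.1.1 0, ?_⟩) ⟨?_, ?_⟩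
  · have h := (hk _).1 ((mem_fixedBy_iff _ _).1 f.2)
    have hl := f.1.leaves
    rw [h 1, h 2, h 3, numLeaves_eq_numNodes_succ] at hl
    omega
  · intro f g hfg
    have h0 : f.1.1 0 = g.1.1 0 := congrArg Subtype.val hfg
    refine Subtype.ext (Subtype.ext (funext fun x => ?_))
    rw [(hk _).1 ((mem_fixedBy_iff _ _).1 f.2) x, (hk _).1 ((mem_fixedBy_iff _ _).1 g.2) x, h0]
  · rintro ⟨t, ht⟩
    refine ⟨⟨⟨fun _ => t, ?_⟩, (mem_fixedBy_iff _ _).2 fun _ => rfl⟩, rfl⟩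
    simp only [sum_zmod_four, numLeaves_eq_numNodes_succ]
    omega

theorem card_fixedBy_one (n : ℕ) :
    Nat.card (MulAction.fixedBy (TreeQuadruple n) (Multiplicative.ofAdd (1 : ZMod 4))) =
      Nat.card {t : BinaryTree Unit // 4 * (t.numNodes + 1) = n} := by
  refine card_fixedBy_of_const fun f => ⟨fun h => ?_, fun h x => by rw [h, h x]⟩
  have h1 : f 1 = f 0 := h 0
  have h2 : f 2 = f 1 := h 1
  have h3 : f 3 = f 2 := h 2
  intro x
  fin_cases x
  · rfl
  · exact h1
  · exact h2.trans h1
  · exact h3.trans (h2.trans h1)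

theorem card_fixedBy_three (n : ℕ) :
    Nat.card (MulAction.fixedBy (TreeQuadruple n) (Multiplicative.ofAdd (3 : ZMod 4))) =
      Nat.card {t : BinaryTree Unit // 4 * (t.numNodes + 1) = n} := by
  refine card_fixedBy_of_const fun f => ⟨fun h => ?_, fun h x => by rw [h, h x]⟩
  have h1 : f 0 = f 1 := h 1
  have h2 : f 1 = f 2 := h 2
  have h3 : f 2 = f 3 := h 3
  intro x
  fin_cases x
  · rfl
  · exact h1.symm
  · exact (h1.trans h2).symm
  · exact (h1.trans (h2.trans h3)).symm

/-- A fixed quadruple is `(a, b, a, b)`; joining `a` and `b` under a root encodes it by one tree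
with `n / 2` leaves. -/
theorem card_fixedBy_two {n : ℕ} (hn : 4 ≤ n) :
    Nat.card (MulAction.fixedBy (TreeQuadruple n) (Multiplicative.ofAdd (2 : ZMod 4))) =
      Nat.card {t : BinaryTree Unit // 2 * (t.numNodes + 1) = n} := by
  have key : ∀ f : MulAction.fixedBy (TreeQuadruple n) (Multiplicative.ofAdd (2 : ZMod 4)),
      f.1.1 2 = f.1.1 0 ∧ f.1.1 3 = f.1.1 1 := fun f =>
    have h := (mem_fixedBy_iff _ _).1 f.2
    ⟨h 0, h 1⟩
  refine Nat.card_eq_of_bijective (fun f => ⟨.node () (f.1.1 0) (f.1.1 1), ?_⟩) ⟨?_, ?_⟩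
  · have hl := f.1.leaves
    rw [(key f).1, (key f).2] at hl
    simp only [numLeaves_eq_numNodes_succ] at hl
    simp only [numNodes]
    omega
  · intro f g hfg
    simp only [Subtype.mk.injEq, node.injEq, true_and] at hfg
    refine Subtype.ext (TreeQuadruple.ext' hfg.1 hfg.2 ?_ ?_)
    · rw [(key f).1, (key g).1, hfg.1]
    · rw [(key f).2, (key g).2, hfg.2]
  · rintro ⟨t, ht⟩
    match t, ht with
    -- The empty tree has one leaf and would force `n = 2`.
    | .nil, ht => simp only [numNodes] at ht; omega
    | .node _ a b, ht =>
      refine ⟨⟨⟨(![a, b, a, b] : Fin 4 → BinaryTree Unit), (sum_zmod_four _).trans ?_⟩,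
        (mem_fixedBy_iff _ _).2 fun x => ?_⟩, rfl⟩
      · change a.numLeaves + b.numLeaves + a.numLeaves + b.numLeaves = n
        simp only [numLeaves_eq_numNodes_succ]
        simp only [numNodes] at ht
        omega
      · fin_cases x <;> rfl

theorem four_mul_card_orbits {n : ℕ} (hn : 4 ≤ n) :
    4 * Nat.card (MulAction.orbitRel.Quotient (Multiplicative (ZMod 4)) (TreeQuadruple n)) =
      Nat.card (TreeQuadruple n) + Nat.card {t : BinaryTree Unit // 2 * (t.numNodes + 1) = n} +
        2 * Nat.card {t : BinaryTree Unit // 4 * (t.numNodes + 1) = n} := by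
  obtain ⟨m, rfl⟩ := Nat.exists_eq_add_of_le' hn
  classical
  have : Fintype (TreeQuadruple (m + 4)) := Fintype.ofFinite _
  have : Fintype (MulAction.orbitRel.Quotient (Multiplicative (ZMod 4))
    (TreeQuadruple (m + 4))) := Fintype.ofFinite _
  have h := MulAction.sum_card_fixedBy_eq_card_orbits_mul_card_group (Multiplicative (ZMod 4))
    (TreeQuadruple (m + 4))
  simp only [← Nat.card_eq_fintype_card] at h
  have h' := (sum_zmod_four fun x => Nat.card (MulAction.fixedBy (TreeQuadruple (m + 4))
    (Multiplicative.ofAdd x))).symm.trans h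
  rw [card_fixedBy_zero, card_fixedBy_one, card_fixedBy_two hn, card_fixedBy_three] at h'
  have h4 : Nat.card (Multiplicative (ZMod 4)) = 4 := Nat.card_zmod 4
  rw [h4] at h'
  change 4 * Nat.card (Quotient _) = _
  omega

theorem card_orbits_treeQuadruple {n : ℕ} (hn : 4 ≤ n) :
    (Nat.card (MulAction.orbitRel.Quotient (Multiplicative (ZMod 4)) (TreeQuadruple n)) : ℚ) =
      ((n : ℚ) - 3) / (2 * (n : ℚ)) * catalanOrZero ((n : ℚ) - 2)
        + 1 / 2 * catalanOrZero ((n : ℚ) / 4 - 1) + 1 / 4 * catalanOrZero ((n : ℚ) / 2 - 1) := by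
  have h := congrArg (Nat.cast : ℕ → ℚ) (four_mul_card_orbits hn)
  have h2 := card_mul_leaves_eq (d := 2) (by norm_num) n
  have h4 := card_mul_leaves_eq (d := 4) (by norm_num) n
  push_cast at h h2 h4
  rw [h2, h4] at h
  obtain ⟨m, rfl⟩ := Nat.exists_eq_add_of_le' hn
  have e : ((m + 4 : ℕ) : ℚ) - 2 = (m + 2 : ℕ) := by push_cast; ring
  rw [e, catalanOrZero_natCast]
  have hW := congrArg (Nat.cast : ℕ → ℚ) (card_treeQuadruple m)
  have hC := congrArg (Nat.cast : ℕ → ℚ) (add_two_mul_catalan_succ (m + 2))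
  push_cast at hW hC
  have hm : (m : ℚ) + 4 ≠ 0 := by positivity
  have hw : (Nat.card (TreeQuadruple (m + 4)) : ℚ) =
      4 * (((m + 4 : ℕ) : ℚ) - 3) / (2 * ((m + 4 : ℕ) : ℚ)) * catalan (m + 2) := by
    push_cast
    field_simp
    -- With `n = m + 4`, the Catalan recursion `n C_{n-1} = 2 (2n - 3) C_{n-2}` turns `C_{n-1} - 2
    -- C_{n-2}` into a multiple of `C_{n-2}`.
    linear_combination 2 * (m + 4 : ℚ) * hW + 2 * hC
  rw [hw] at h
  linear_combination h / 4

end PolygonDissection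

theorem theorem2 (n : ℕ) (hn : 4 ≤ n) :
    (Nat.card (MulAction.orbitRel.Quotient (PolygonDissection.Rotations n)
        (PolygonDissection.kDissections n (n - 4))) : ℚ) =
      ((n : ℚ) - 3) / (2 * (n : ℚ)) * PolygonDissection.catalanOrZero ((n : ℚ) - 2)
        + 1 / 2 * PolygonDissection.catalanOrZero ((n : ℚ) / 4 - 1)
        + 1 / 4 * PolygonDissection.catalanOrZero ((n : ℚ) / 2 - 1) ∧
    (Nat.card (MulAction.orbitRel.Quotient (PolygonDissection.Rotations n)
        (PolygonDissection.associahedronEdges n)) : ℚ) =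
      ((n : ℚ) - 3) / (2 * (n : ℚ)) * PolygonDissection.catalanOrZero ((n : ℚ) - 2)
        + 1 / 2 * PolygonDissection.catalanOrZero ((n : ℚ) / 4 - 1)
        + 1 / 4 * PolygonDissection.catalanOrZero ((n : ℚ) / 2 - 1) := by
  have : NeZero n := ⟨by omega⟩
  rw [PolygonDissection.card_orbits_associahedronEdges hn,
    PolygonDissection.card_orbits_kDissections hn]
  exact ⟨PolygonDissection.card_orbits_treeQuadruple hn,
    PolygonDissection.card_orbits_treeQuadruple hn⟩
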